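/- **Theorem 1.1.** Let $\Omega\subset\mathbb R^n$ $(n\ge 2)$ be a bounded domain (non-empty, open and connected) and let $u\in C^4(\Omega)\cap C^2(\overline\Omega)$, where $C^2(\overline\Omega)$ means that $u$, $\nabla u$ and $D^2u$ extend continuously from $\Omega$ to $\overline\Omega$; the extensions are denoted by the same symbols. Suppose that $$\operatorname{div}\Big(\frac{\nabla u}{\sqrt{1+|\nabla u|^2}}\Big)=0\quad\text{in }\Omega,\qquad \nabla u\neq 0\quad\text{in }\Omega,$$ and that the level sets of $u$ in $\Omega$ are strictly convex with respect to the normal $\nabla u$, i.e. at every point of $\Omega$ their second fundamental form $\mathrm{II}(X,Y)=-D^2u(X,Y)/|\nabla u|$ on $(\nabla u)^\perp$ is positive definite. Let $R=\{x\in\overline\Omega:\nabla u(x)\ne0\}$ (so $\Omega\subset R$), let $K$ be the Gaussian curvature of the level sets, i.e. the determinant of $\mathrm{II}$ in an orthonormal basis of $(\nabla u)^\perp$, defined on $R$, and for $\theta\in\mathbb R$ put $$\psi_\theta=\Big(\frac{|\nabla u|^2}{1+|\nabla u|^2}\Big)^{\theta}K\qquad\text{on }R.$$ We say that $\psi_\theta$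 *attains its minimum on $\partial\Omega$ only* if there is $p\in\partial\Omega$ such that for every $y\in\Omega$ there are points $x\in\Omega$ arbitrarily close to $p$ with $\psi_\theta(x)<\psi_\theta(y)$ and, if $\nabla u(p)\neq0$, moreover $\psi_\theta(p)\le\psi_\theta(y)$ for all $y\in R$ and $\psi_\theta(p)<\psi_\theta(y)$ for all $y\in\Omega$. The corresponding property for the maximum is obtained by reversing the inequalities between values of $\psi_\theta$. (If $\nabla u\ne0$ on $\partial\Omega$, then $R=\overline\Omega$ and these are the usual notions for the function $\psi_\theta$ on $\overline\Omega$, with no extremum in $\Omega$; at a boundary point where $\nabla u=0$, where $\psi_\theta$ is not defined, the boundary value is replaced by the lower, respectively upper, limit.) (i) If $n=2$, then either $\psi_{-1/2}$ is constant on $R$, or it attains both its minimum and its maximum on $\partial\Omega$ only. (ii) If $n\ge3$ and $\theta=-\tfrac12$ or $\theta\ge\tfrac{n-3}{2}$, then either $\psi_\theta$ is constant on $R$, or it attains its minimum on $\partial\Omega$ only. -/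

import Mathlib

open Set Filter Topology
open scoped Gradient

noncomputable section

/-- Euclidean space `ℝⁿ`. -/
abbrev Euc (n : ℕ) : Type := EuclideanSpace ℝ (Fin n)

/-- The Hessian `D²u(x)`, as the derivative of the gradient field: a linear operator of `ℝⁿ`. -/
def hessianOp {n : ℕ} (u : Euc n → ℝ) (x : Euc n) : Euc n →L[ℝ] Euc n :=
  fderiv ℝ (∇ u) x

/-- The divergence of a vector field, the trace of its derivative. -/
def divergence {n : ℕ} (V : Euc n → Euc n) (x : Euc n) : ℝ :=
  LinearMap.trace ℝ (Euc n) (fderiv ℝ V x : Euc n →ₗ[ℝ] Euc n)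

/-- The minimal surface equation `div (∇u / √(1 + |∇u|²)) = 0` in `Ω`. -/
def SolvesMinimalSurfaceEq {n : ℕ} (Ω : Set (Euc n)) (u : Euc n → ℝ) : Prop :=
  ∀ x ∈ Ω, divergence (fun y => (Real.sqrt (1 + ‖∇ u y‖ ^ 2))⁻¹ • ∇ u y) x = 0

/-- `f`, defined on `Ω`, has a continuous extension to the closure of `Ω`. -/
def ExtendsToClosure {n : ℕ} {F : Type*} [TopologicalSpace F] (Ω : Set (Euc n))
    (f : Euc n → F) : Prop :=
  ∃ g : Euc n → F, ContinuousOn g (closure Ω) ∧ EqOn g f Ω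

/-- `u ∈ C²(Ω̄)`: `u` is `C²` in the open set `Ω`, and `u`, `∇u`, `D²u` extend continuously to the
closure of `Ω`. -/
def IsC2UpToBoundary {n : ℕ} (Ω : Set (Euc n)) (u : Euc n → ℝ) : Prop :=
  ContDiffOn ℝ 2 u Ω ∧ ExtendsToClosure Ω u ∧ ExtendsToClosure Ω (∇ u) ∧
    ExtendsToClosure Ω (hessianOp u)

/-- The shape operator, with respect to the unit normal `g / |g|`, of the level set through a
point at which a function has gradient `g ≠ 0` and Hessian `A`. It acts on the tangent space
`g^⊥` of the level set by `X ↦ -|g|⁻¹ • (A X)^⊤`, which is minus the derivative of the unit normal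
field; so `⟪S X, Y⟫ = -D²u(X, Y) / |∇u|` is the second fundamental form, positive when the level
set bends towards `g`. -/
def levelShapeOp {n : ℕ} (g : Euc n) (A : Euc n →L[ℝ] Euc n) :
    (ℝ ∙ g)ᗮ →ₗ[ℝ] (ℝ ∙ g)ᗮ :=
  (-‖g‖⁻¹) • (((ℝ ∙ g)ᗮ.orthogonalProjectionOnto ∘L A ∘L (ℝ ∙ g)ᗮ.subtypeL :
    (ℝ ∙ g)ᗮ →L[ℝ] (ℝ ∙ g)ᗮ) : (ℝ ∙ g)ᗮ →ₗ[ℝ] (ℝ ∙ g)ᗮ)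

/-- The Gaussian curvature of the level set, the product of its principal curvatures. -/
def levelGaussCurv {n : ℕ} (g : Euc n) (A : Euc n →L[ℝ] Euc n) : ℝ :=
  LinearMap.det (levelShapeOp g A)

/-- The level sets of `u` in `Ω` are strictly convex with respect to the normal `∇u`: their second
fundamental form is positive definite at each point. -/
def StrictlyConvexLevelSets {n : ℕ} (Ω : Set (Euc n)) (u : Euc n → ℝ) : Prop :=
  ∀ x ∈ Ω, ∀ X : (ℝ ∙ (∇ u x))ᗮ, X ≠ 0 →
    0 < inner ℝ (levelShapeOp (∇ u x) (hessianOp u x) X) X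

/-- The gradient of `u` on the closure of `Ω`, extended continuously from `Ω`. -/
def gradBar {n : ℕ} (Ω : Set (Euc n)) (u : Euc n → ℝ) : Euc n → Euc n :=
  extendFrom Ω (∇ u)

/-- The Hessian of `u` on the closure of `Ω`, extended continuously from `Ω`. -/
def hessBar {n : ℕ} (Ω : Set (Euc n)) (u : Euc n → ℝ) : Euc n → (Euc n →L[ℝ] Euc n) :=
  extendFrom Ω (hessianOp u)

/-- The points of the closure of `Ω` at which the gradient of `u` does not vanish, that is, at
which the curvature of the level set is defined. -/
def regularSet {n : ℕ} (Ω : Set (Euc n)) (u : Euc n → ℝ) : Set (Euc n) :=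
  {x ∈ closure Ω | gradBar Ω u x ≠ 0}

/-- The function `(|∇u|² / (1 + |∇u|²))^θ · K` on `regularSet Ω u`. -/
def weightedCurv {n : ℕ} (Ω : Set (Euc n)) (u : Euc n → ℝ) (θ : ℝ) (x : Euc n) : ℝ :=
  (‖gradBar Ω u x‖ ^ 2 / (1 + ‖gradBar Ω u x‖ ^ 2)) ^ θ *
    levelGaussCurv (gradBar Ω u x) (hessBar Ω u x)

/-- `f` is constant on `R`. -/
def ConstantOn {n : ℕ} (R : Set (Euc n)) (f : Euc n → ℝ) : Prop :=
  ∃ c : ℝ, ∀ x ∈ R, f x = c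

/-- For a function `f` defined on a set `R` with `Ω ⊆ R ⊆ closure Ω`: some point `p` of the boundary
of `Ω` is a minimum point of `f`, and no point of `Ω` is one. If `p ∈ R` this is said of the value
`f p`. At a boundary point outside `R`, where `f` is not defined, it is said of the values of
`f` near `p`: for each `y ∈ Ω` there are points `x ∈ Ω` arbitrarily close to `p` with
`f x < f y`, i.e. the lower limit of `f` at `p` is the infimum of `f` over `Ω`, not attained
in `Ω`. (The latter holds when `p ∈ R`, too.) -/
def MinOnBoundary {n : ℕ} (Ω R : Set (Euc n)) (f : Euc n → ℝ) : Prop :=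
  ∃ p ∈ frontier Ω,
    (∀ y ∈ Ω, ∃ᶠ x in 𝓝[Ω] p, f x < f y) ∧
    (p ∈ R → (∀ y ∈ R, f p ≤ f y) ∧ ∀ y ∈ Ω, f p < f y)

/-- The same for the maximum. -/
def MaxOnBoundary {n : ℕ} (Ω R : Set (Euc n)) (f : Euc n → ℝ) : Prop :=
  ∃ p ∈ frontier Ω,
    (∀ y ∈ Ω, ∃ᶠ x in 𝓝[Ω] p, f y < f x) ∧
    (p ∈ R → (∀ y ∈ R, f y ≤ f p) ∧ ∀ y ∈ Ω, f y < f p)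

end

/-! Write m = n - 1, s = |∇u|, φ = log ψ_θ, let κ be the principal curvatures of the level set and H
their sum. At a point of Ω take a frame of principal directions and the normal ν. In it the
linearized equation has the principal part L = (1 + s²) ∑ ∂_k² + ∂_ν². The theorem rests on a
differential inequality L φ ≤ C |∇φ| with C locally bounded, to which the strong minimum principle
applies (`eq_of_isMinOn_of_isSupersolutionAt`): either ψ_θ is constant, or it has no minimum in Ω.
In the second case a cluster point of the sublevel sets is the required boundary point
(`minOnBoundary_of_forall_exists_lt`).

To differentiate K without moving frames, note that |∇u|^(n+1) K is, up to a constant factor, the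
determinant of the bordered Hessian of u in any fixed frame of ℝⁿ × ℝ
(`exists_det_borderedGram_eq`). The frame is chosen so that this matrix is block diagonal with known
inverse at the point considered; the derivatives of log |det| are then traces, and the fourth
derivatives are eliminated by differentiating the equation twice.

The outcome is the identity `LevelJet.L_logCurv₂`: L φ is minus two weighted sums of squares of
shifted third derivatives, minus quadratic terms in a_k = u_{kν} and in κ, minus terms linear in ∇φ.
The quadratic terms need not have a sign by themselves. However, the weighted traces of the squared
arrays are multiples of a_k and H modulo ∇φ, so Cauchy–Schwarz on the diagonals returns further
multiples of a_k² and H². With these added both quadratic forms are nonnegative for the admissible θ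
(`LevelJet.curvature_terms_nonneg`, `LevelJet.mixed_terms_nonneg`), which gives
`LevelJet.L_logCurv₂_le`.

For n = 2 each array has a single entry, Cauchy–Schwarz is an equality, and for θ = -1/2 all that
remains is L φ = -((1 + s²) φ_k² + φ_ν²). Thus L ψ = 0, and the principle applies to -ψ as well. -/

/-! ### Calculus of second order jets of functions of one variable. -/

/-- The function `f` of one variable has value `f₀`, derivative `f₁` and second derivative `f₂`
at `0`. -/
structure HasJet (f : ℝ → ℝ) (f₀ f₁ f₂ : ℝ) : Prop where
  val : f 0 = f₀
  exists_deriv : ∃ p : ℝ → ℝ, (∀ᶠ t in 𝓝 0, HasDerivAt f (p t) t) ∧ p 0 = f₁ ∧ HasDerivAt p f₂ 0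

namespace HasJet

variable {f g : ℝ → ℝ} {f₀ f₁ f₂ g₀ g₁ g₂ : ℝ}

theorem hasDerivAt (hf : HasJet f f₀ f₁ f₂) : HasDerivAt f f₁ 0 := by
  obtain ⟨-, p, hp, rfl, -⟩ := hf
  exact hp.self_of_nhds

theorem congr (hf : HasJet f f₀ f₁ f₂) {h₀ h₁ h₂ : ℝ} (e₀ : f₀ = h₀) (e₁ : f₁ = h₁)
    (e₂ : f₂ = h₂) : HasJet f h₀ h₁ h₂ := by
  subst e₀ e₁ e₂; exact hf

theorem congr_of_eventuallyEq (hf : HasJet f f₀ f₁ f₂) (h : g =ᶠ[𝓝 0] f) :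
    HasJet g f₀ f₁ f₂ := by
  obtain ⟨h0, p, hp, h1, h2⟩ := hf
  refine ⟨h.self_of_nhds.trans h0, p, ?_, h1, h2⟩
  filter_upwards [hp, h.eventually_nhds] with t ht ht'
  exact ht.congr_of_eventuallyEq ht'

theorem unique (hf : HasJet f f₀ f₁ f₂) (hg : HasJet f g₀ g₁ g₂) : f₁ = g₁ ∧ f₂ = g₂ := by
  obtain ⟨-, p, hp, rfl, h2⟩ := hf
  obtain ⟨-, q, hq, rfl, k2⟩ := hg
  have h : p =ᶠ[𝓝 0] q := by
    filter_upwards [hp, hq] with t ht ht' using ht.unique ht'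
  exact ⟨h.self_of_nhds, h2.unique (k2.congr_of_eventuallyEq h)⟩

theorem const (c : ℝ) : HasJet (fun _ => c) c 0 0 :=
  ⟨rfl, fun _ => 0, .of_forall fun t => hasDerivAt_const t c, rfl, hasDerivAt_const _ _⟩

theorem add (hf : HasJet f f₀ f₁ f₂) (hg : HasJet g g₀ g₁ g₂) :
    HasJet (fun t => f t + g t) (f₀ + g₀) (f₁ + g₁) (f₂ + g₂) := by
  obtain ⟨rfl, p, hp, rfl, h2⟩ := hf
  obtain ⟨rfl, q, hq, rfl, k2⟩ := hg
  refine ⟨rfl, fun t => p t + q t, ?_, rfl, h2.fun_add k2⟩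
  filter_upwards [hp, hq] with t ht ht' using ht.fun_add ht'

theorem mul (hf : HasJet f f₀ f₁ f₂) (hg : HasJet g g₀ g₁ g₂) :
    HasJet (fun t => f t * g t) (f₀ * g₀) (f₁ * g₀ + f₀ * g₁)
      (f₂ * g₀ + 2 * (f₁ * g₁) + f₀ * g₂) := by
  have hf' := hf.hasDerivAt
  have hg' := hg.hasDerivAt
  obtain ⟨rfl, p, hp, rfl, h2⟩ := hf
  obtain ⟨rfl, q, hq, rfl, k2⟩ := hg
  refine ⟨rfl, fun t => p t * g t + f t * q t, ?_, rfl, ?_⟩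
  · filter_upwards [hp, hq] with t ht ht' using ht.fun_mul ht'
  · exact ((h2.fun_mul hg').fun_add (hf'.fun_mul k2)).congr_deriv (by ring)

theorem const_mul (c : ℝ) (hf : HasJet f f₀ f₁ f₂) :
    HasJet (fun t => c * f t) (c * f₀) (c * f₁) (c * f₂) :=
  ((const c).mul hf).congr rfl (by ring) (by ring)

theorem neg (hf : HasJet f f₀ f₁ f₂) : HasJet (fun t => -f t) (-f₀) (-f₁) (-f₂) := by
  have := hf.const_mul (-1)
  simpa using this

theorem sub (hf : HasJet f f₀ f₁ f₂) (hg : HasJet g g₀ g₁ g₂) :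
    HasJet (fun t => f t - g t) (f₀ - g₀) (f₁ - g₁) (f₂ - g₂) := by
  simpa [sub_eq_add_neg] using hf.add hg.neg

theorem sum {ι : Type*} (s : Finset ι) {f : ι → ℝ → ℝ} {f₀ f₁ f₂ : ι → ℝ}
    (hf : ∀ i ∈ s, HasJet (f i) (f₀ i) (f₁ i) (f₂ i)) :
    HasJet (fun t => ∑ i ∈ s, f i t) (∑ i ∈ s, f₀ i) (∑ i ∈ s, f₁ i) (∑ i ∈ s, f₂ i) := by
  classical
  induction s using Finset.induction_on with
  | empty => simpa using const 0
  | insert a s ha ih =>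
    simp only [Finset.sum_insert ha]
    exact (hf a (Finset.mem_insert_self _ _)).add
      (ih fun i hi => hf i (Finset.mem_insert_of_mem hi))

theorem comp {h h' : ℝ → ℝ} {h₂ : ℝ} (hf : HasJet f f₀ f₁ f₂)
    (hh : ∀ᶠ y in 𝓝 f₀, HasDerivAt h (h' y) y) (hh' : HasDerivAt h' h₂ f₀) :
    HasJet (fun t => h (f t)) (h f₀) (h' f₀ * f₁) (h₂ * f₁ ^ 2 + h' f₀ * f₂) := by
  have hf' := hf.hasDerivAt
  obtain ⟨rfl, p, hp, rfl, h2⟩ := hf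
  refine ⟨rfl, fun t => h' (f t) * p t, ?_, rfl, ?_⟩
  · filter_upwards [hp, hf'.continuousAt.eventually hh] with t ht ht'
    exact ht'.comp t ht
  · refine ((hh'.comp 0 hf').fun_mul h2).congr_deriv ?_
    simp only [Function.comp]; ring

theorem log (hf : HasJet f f₀ f₁ f₂) (h0 : f₀ ≠ 0) :
    HasJet (fun t => Real.log (f t)) (Real.log f₀) (f₁ / f₀) (f₂ / f₀ - (f₁ / f₀) ^ 2) := by
  refine (hf.comp (h' := fun y => y⁻¹) (h₂ := -(f₀ ^ 2)⁻¹) ?_ (hasDerivAt_inv h0)).congr rfl ?_ ?_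
  · filter_upwards [isOpen_ne.mem_nhds h0] with y hy using Real.hasDerivAt_log hy
  · field_simp
  · field_simp; ring

theorem exp (hf : HasJet f f₀ f₁ f₂) :
    HasJet (fun t => Real.exp (f t)) (Real.exp f₀) (Real.exp f₀ * f₁)
      (Real.exp f₀ * (f₁ ^ 2 + f₂)) :=
  (hf.comp (.of_forall Real.hasDerivAt_exp) (Real.hasDerivAt_exp f₀)).congr rfl rfl (by ring)

theorem id : HasJet (fun t => t) 0 1 0 :=
  ⟨rfl, fun _ => 1, .of_forall hasDerivAt_id, rfl, hasDerivAt_const _ _⟩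

/-- If `f₂ < 0`, the second derivative test makes 0 a local minimum of `-f` too, so `f` is locally
constant and `f₂ = 0`. -/
theorem second_deriv_nonneg (hf : HasJet f f₀ f₁ f₂) (hmin : IsLocalMin f 0) : 0 ≤ f₂ := by
  have h1 : f₁ = 0 := hmin.hasDerivAt_eq_zero hf.hasDerivAt
  by_contra! hlt
  have hg := hf.neg
  have hcont : ContinuousAt (fun t => -f t) 0 := hg.hasDerivAt.continuousAt
  obtain ⟨-, p, hp, hp0, hp2⟩ := hg
  have hd : deriv (fun t => -f t) =ᶠ[𝓝 0] p := by
    filter_upwards [hp] with t ht using ht.deriv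
  have hmax : IsLocalMin (fun t => -f t) 0 := by
    refine isLocalMin_of_deriv_deriv_pos ?_ ?_ hcont
    · rw [hd.deriv_eq, hp2.deriv]; linarith
    · rw [hd.self_of_nhds, hp0, h1, neg_zero]
  have hc : f =ᶠ[𝓝 0] fun _ => f 0 := by
    filter_upwards [hmin, hmax] with t ht ht'
    simp only [neg_le_neg_iff] at ht'
    exact le_antisymm ht' ht
  have := (hf.congr_of_eventuallyEq hc.symm).unique (const (f 0))
  linarith [this.2]

end HasJet

/-! ### The strong minimum principle, by Hopf's barrier argument. -/

section StrongMinimumPrinciple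

variable {E ι : Type*} [NormedAddCommGroup E] [InnerProductSpace ℝ E] [Fintype ι]

/-- At `x` the function `φ` satisfies, in some orthonormal basis, the second order differential
inequality `∑ wᵢ ∂ᵢ²φ ≤ C ∑ |∂ᵢφ|` with weights `wᵢ` between `1` and `C`. -/
def IsSupersolutionAt (ι : Type*) [Fintype ι] (φ : E → ℝ) (C : ℝ) (x : E) : Prop :=
  ∃ (e : OrthonormalBasis ι ℝ E) (w p q : ι → ℝ), (∀ i, 1 ≤ w i ∧ w i ≤ C) ∧
    (∀ i, HasJet (fun t => φ (x + t • e i)) (φ x) (p i) (q i)) ∧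
    ∑ i, w i * q i ≤ C * ∑ i, |p i|

theorem hasJet_norm_sq_line (x y v : E) (hv : ‖v‖ = 1) :
    HasJet (fun t : ℝ => ‖x + t • v - y‖ ^ 2) (‖x - y‖ ^ 2) (2 * inner ℝ (x - y) v) 2 := by
  have h : (fun t : ℝ => ‖x + t • v - y‖ ^ 2)
      = fun t => ‖x - y‖ ^ 2 + ((2 * inner ℝ (x - y) v) * t + t * t) := by
    funext t
    rw [show x + t • v - y = (x - y) + t • v by abel, norm_add_sq_real, inner_smul_right,
      norm_smul, hv, mul_one, Real.norm_eq_abs, sq_abs]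
    ring
  rw [h]
  exact ((HasJet.const _).add ((HasJet.id.const_mul _).add (HasJet.id.mul HasJet.id))).congr
    (by ring) (by ring) (by ring)

/-- A strict inequality for the radial barrier `exp (-α |x - y|²)` excludes interior minima of
`φ - ε h`. -/
theorem not_isLocalMin_sub_barrier {φ : E → ℝ} {C α ε μ : ℝ} {x y : E}
    (hφ : IsSupersolutionAt ι φ C x) (hε : 0 < ε) (hα : 0 < α)
    (hlarge : Fintype.card ι * C * (1 + ‖x - y‖) < 2 * α * ‖x - y‖ ^ 2) :
    ¬ IsLocalMin (fun z => φ z - ε * (Real.exp (-α * ‖z - y‖ ^ 2) - μ)) x := by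
  intro hmin
  obtain ⟨e, w, p, q, hw, hj, hle⟩ := hφ
  set ρ := ‖x - y‖ with hρ
  set v := Real.exp (-α * ρ ^ 2) with hv
  have hv0 : 0 < v := Real.exp_pos _
  set d : ι → ℝ := fun i => inner ℝ (x - y) (e i) with hd
  have hjets : ∀ i, HasJet
      (fun t => φ (x + t • e i) - ε * (Real.exp (-α * ‖x + t • e i - y‖ ^ 2) - μ))
      (φ x - ε * (v - μ)) (p i - ε * (v * (-α * (2 * d i)) - 0))
      (q i - ε * (v * ((-α * (2 * d i)) ^ 2 + -α * 2) - 0)) := fun i =>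
    (hj i).sub (((((hasJet_norm_sq_line x y (e i) (e.norm_eq_one i)).const_mul (-α)).exp).sub
      (HasJet.const μ)).const_mul ε)
  have hloc : ∀ i, IsLocalMin
      (fun t : ℝ => φ (x + t • e i) - ε * (Real.exp (-α * ‖x + t • e i - y‖ ^ 2) - μ)) 0 := by
    intro i
    have hc : ContinuousAt (fun t : ℝ => x + t • e i) 0 := by fun_prop
    have h0 : x + (0 : ℝ) • e i = x := by simp
    have hmin' : IsLocalMin (fun z => φ z - ε * (Real.exp (-α * ‖z - y‖ ^ 2) - μ))
      (x + (0 : ℝ) • e i) := by rwa [h0]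
    exact IsLocalMin.comp_continuous (g := fun t : ℝ => x + t • e i) (b := 0) hmin' hc
  have hp : ∀ i, p i = -(ε * v * (2 * α) * d i) := fun i => by
    have := (hloc i).hasDerivAt_eq_zero (hjets i).hasDerivAt
    linarith
  have hq : ∀ i, ε * v * (4 * α ^ 2 * d i ^ 2 - 2 * α) ≤ q i := fun i => by
    have := (hjets i).second_deriv_nonneg (hloc i)
    linarith
  -- By Parseval the barrier estimates do not depend on the orthonormal basis, so the basis may vary
  -- with the point without any regularity.
  have hsum : ∑ i, d i ^ 2 = ρ ^ 2 := by
    have := e.sum_sq_norm_inner_left (x - y)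
    simpa [hd, sq_abs] using this
  have hdρ : ∀ i, |d i| ≤ ρ := fun i => by
    have := abs_real_inner_le_norm (x - y) (e i)
    rwa [e.norm_eq_one, mul_one] at this
  have hC : 0 ≤ Fintype.card ι * C := by
    rcases isEmpty_or_nonempty ι with h | ⟨⟨i⟩⟩
    · simp
    · have := (hw i).1.trans (hw i).2
      positivity
  have hεv : 0 < ε * v := by positivity
  -- At a minimum of the difference, φ inherits the gradient of the barrier and at least its second
  -- derivatives. The term in α² gains from the weights being at least 1, the term in α loses at
  -- most the factor C.
  have key1 : ε * v * (4 * α ^ 2 * ρ ^ 2 - 2 * α * (Fintype.card ι * C)) ≤ ∑ i, w i * q i := by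
    have : ∀ i ∈ Finset.univ, ε * v * (4 * α ^ 2 * d i ^ 2 - 2 * α * C) ≤ w i * q i := by
      intro i _
      have h1 := mul_le_mul_of_nonneg_left (hq i) (zero_le_one.trans (hw i).1)
      refine le_trans ?_ h1
      have h2 : 0 ≤ (w i - 1) * (ε * v * (4 * α ^ 2 * d i ^ 2)) :=
        mul_nonneg (by linarith [(hw i).1]) (by positivity)
      have h3 : 0 ≤ (C - w i) * (ε * v * (2 * α)) :=
        mul_nonneg (by linarith [(hw i).2]) (by positivity)
      linarith
    refine le_trans (le_of_eq ?_) (Finset.sum_le_sum this)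
    rw [← Finset.mul_sum, Finset.sum_sub_distrib, ← Finset.mul_sum, hsum]
    simp only [Finset.sum_const, Finset.card_univ, nsmul_eq_mul]
    ring
  have key2 : C * ∑ i, |p i| ≤ ε * v * (2 * α * (Fintype.card ι * C) * ρ) := by
    rcases isEmpty_or_nonempty ι with h | ⟨⟨i₀⟩⟩
    · simp
    have hC0 : 0 ≤ C := zero_le_one.trans ((hw i₀).1.trans (hw i₀).2)
    have : ∑ i, |p i| ≤ ∑ _i : ι, ε * v * (2 * α) * ρ := by
      refine Finset.sum_le_sum fun i _ => ?_
      rw [hp, abs_neg, abs_mul, abs_of_pos (by positivity : 0 < ε * v * (2 * α))]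
      exact mul_le_mul_of_nonneg_left (hdρ i) (by positivity)
    refine (mul_le_mul_of_nonneg_left this hC0).trans (le_of_eq ?_)
    simp only [Finset.sum_const, Finset.card_univ, nsmul_eq_mul]
    ring
  have key3 := mul_lt_mul_of_pos_left hlarge (by positivity : 0 < ε * v * (2 * α))
  have key4 := key1.trans (hle.trans key2)
  nlinarith

variable [FiniteDimensional ℝ E]

/-- Let `z` be a point of the level set nearest to `y'`. The ball about `y'` through `z` may meet
the level set at other points of its sphere; the ball of half the radius about the midpoint of `y'`
and `z` meets it at `z` only. The factor 3 keeps all the balls involved inside Ω. -/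
theorem exists_ball_touching {φ : E → ℝ} {Ω : Set E} (hφc : ContinuousOn φ Ω) {z₀ : E} {r : ℝ}
    (hr : 0 < r) (hball : Metric.closedBall z₀ (3 * r) ⊆ Ω) {y' : E} (hy' : dist y' z₀ < r)
    (hne : φ y' ≠ φ z₀) :
    ∃ z y : E, ∃ R : ℝ, 0 < R ∧ φ z = φ z₀ ∧ dist z y = R ∧
      Metric.closedBall z (R / 2) ⊆ Ω ∧
      ∀ x ∈ Metric.closedBall y R, φ x = φ z₀ → x = z := by
  set Z := Metric.closedBall z₀ (3 * r) ∩ {x | φ x = φ z₀} with hZ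
  have hZc : IsCompact Z := by
    have h1 : IsClosed Z := by
      have := (hφc.mono hball).preimage_isClosed_of_isClosed Metric.isClosed_closedBall
        (isClosed_singleton (x := φ z₀))
      exact this
    exact (isCompact_closedBall z₀ (3 * r)).of_isClosed_subset h1 inter_subset_left
  have hZn : Z.Nonempty := ⟨z₀, Metric.mem_closedBall_self (by positivity), rfl⟩
  obtain ⟨z, ⟨hzb, hz⟩, hdz⟩ := hZc.exists_infDist_eq_dist hZn y'
  have hzle : dist y' z ≤ dist y' z₀ := by
    rw [← hdz]
    exact Metric.infDist_le_dist_of_mem ⟨Metric.mem_closedBall_self (by positivity), rfl⟩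
  set d := dist y' z with hd
  have hd0 : 0 < d := by
    rw [hd, dist_pos]; rintro rfl; exact hne hz
  refine ⟨z, midpoint ℝ y' z, d / 2, by positivity, hz, ?_, ?_, ?_⟩
  · rw [dist_comm, dist_midpoint_right, Real.norm_of_nonneg (by norm_num : (0 : ℝ) ≤ 2)]
    ring
  · refine Subset.trans (fun x hx => ?_) hball
    rw [Metric.mem_closedBall] at hx ⊢
    have h1 := dist_triangle x z z₀
    have h2 := dist_triangle z y' z₀
    rw [dist_comm z y'] at h2
    linarith
  · intro x hx hxz
    rw [Metric.mem_closedBall] at hx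
    have hfar : d ≤ dist x y' := by
      by_contra! hlt
      have hxZ : x ∈ Z := by
        refine ⟨?_, hxz⟩
        rw [Metric.mem_closedBall]
        have := dist_triangle x y' z₀
        linarith
      have := Metric.infDist_le_dist_of_mem (x := y') hxZ
      rw [hdz, dist_comm] at this
      linarith
    -- With M the midpoint, |x - y'|² + |x - z|² = 2|x - M|² + 2|M - y'|² ≤ d², while |x - y'| ≥ d;
    -- hence x = z.
    have hpar := parallelogram_law_with_norm ℝ (x - midpoint ℝ y' z) (midpoint ℝ y' z - y')
    have e1 : x - midpoint ℝ y' z + (midpoint ℝ y' z - y') = x - y' := by abel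
    have e2 : x - midpoint ℝ y' z - (midpoint ℝ y' z - y') = x - z := by
      have h := midpoint_add_self ℝ y' z
      generalize midpoint ℝ y' z = M at h
      have hz' : z = M + M - y' := by rw [h]; abel
      rw [hz']; abel
    have e3 : ‖midpoint ℝ y' z - y'‖ = d / 2 := by
      rw [← dist_eq_norm, dist_midpoint_left, Real.norm_of_nonneg (by norm_num : (0 : ℝ) ≤ 2)]
      ring
    rw [e1, e2, e3, ← dist_eq_norm, ← dist_eq_norm, ← dist_eq_norm] at hpar
    have h0 : dist x z * dist x z ≤ 0 := by
      nlinarith [dist_nonneg (x := x) (y := midpoint ℝ y' z)]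
    exact dist_eq_zero.mp (by nlinarith [dist_nonneg (x := x) (y := z)])

/-- The strong minimum principle. -/
theorem eq_of_isMinOn_of_isSupersolutionAt {φ C : E → ℝ} {Ω : Set E} (hΩ : IsOpen Ω)
    (hΩc : IsPreconnected Ω) (hφc : ContinuousOn φ Ω) (hC : ContinuousOn C Ω)
    (hφ : ∀ x ∈ Ω, IsSupersolutionAt ι φ (C x) x) {z₀ : E} (hz₀ : z₀ ∈ Ω)
    (hmin : ∀ x ∈ Ω, φ z₀ ≤ φ x) : ∀ x ∈ Ω, φ x = φ z₀ := by
  set μ := φ z₀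
  have hopen : ∀ z₁ ∈ Ω, φ z₁ = μ → ∀ᶠ x in 𝓝 z₁, φ x = μ := by
    intro z₁ hz₁ hμ
    obtain ⟨r₀, hr₀, hball₀⟩ := Metric.nhds_basis_closedBall.mem_iff.mp (hΩ.mem_nhds hz₁)
    by_contra hcon
    have hfr : ∃ᶠ x in 𝓝 z₁, ¬ φ x = μ := not_eventually.mp hcon
    obtain ⟨y', hy', hy'b⟩ := (hfr.and_eventually
      (Metric.ball_mem_nhds z₁ (by positivity : 0 < r₀ / 3))).exists
    rw [← hμ] at hy'
    obtain ⟨z, y, R, hR, hz, hzy, hsub, honly⟩ := exists_ball_touching hφc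
      (by positivity : 0 < r₀ / 3) (by rwa [mul_div_cancel₀ _ (by norm_num : (3 : ℝ) ≠ 0)])
      hy'b hy'
    rw [hμ] at hz honly
    obtain ⟨C₀, hC₀⟩ := (isCompact_closedBall z (R / 2)).bddAbove_image (hC.mono hsub)
    have hC₀' : ∀ x ∈ Metric.closedBall z (R / 2), C x ≤ C₀ := fun x hx =>
      hC₀ (mem_image_of_mem C hx)
    have hkc : IsCompact (Metric.sphere z (R / 2) ∩ Metric.closedBall y R) :=
      (isCompact_sphere z (R / 2)).inter_right Metric.isClosed_closedBall
    have hδ : ∃ δ > 0, ∀ x ∈ Metric.sphere z (R / 2) ∩ Metric.closedBall y R, μ + δ ≤ φ x := by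
      have hks : Metric.sphere z (R / 2) ∩ Metric.closedBall y R ⊆ Ω :=
        (inter_subset_left.trans Metric.sphere_subset_closedBall).trans hsub
      rcases (Metric.sphere z (R / 2) ∩ Metric.closedBall y R).eq_empty_or_nonempty with h | h
      · exact ⟨1, one_pos, by simp [h]⟩
      · obtain ⟨x₁, hx₁, hx₁m⟩ := hkc.exists_isMinOn h (hφc.mono hks)
        have h1 := hmin x₁ (hks hx₁)
        have h2 : φ x₁ ≠ μ := fun he => by
          have := honly x₁ hx₁.2 he
          have hs := Metric.mem_sphere.mp hx₁.1
          rw [this, dist_self] at hs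
          linarith
        have h3 : μ < φ x₁ := lt_of_le_of_ne h1 h2.symm
        exact ⟨φ x₁ - μ, by linarith, fun x hx => by
          have : φ x₁ ≤ φ x := hx₁m hx
          linarith⟩
    obtain ⟨δ, hδ0, hδ⟩ := hδ
    -- On the ball of radius R/2 about `z` the distance to `y` lies between R/2 and 2R, so one α
    -- meets the barrier condition on the whole ball.
    obtain ⟨α, hα0, hα⟩ : ∃ α : ℝ, 0 < α ∧
        Fintype.card ι * |C₀| * (1 + 2 * R) < 2 * α * (R / 2) ^ 2 := by
      refine ⟨(Fintype.card ι * |C₀| * (1 + 2 * R) + 1) / (2 * (R / 2) ^ 2), by positivity, ?_⟩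
      have : 2 * ((Fintype.card ι * |C₀| * (1 + 2 * R) + 1) / (2 * (R / 2) ^ 2)) * (R / 2) ^ 2
        = Fintype.card ι * |C₀| * (1 + 2 * R) + 1 := by field_simp
      linarith
    set h : E → ℝ := fun x => Real.exp (-α * ‖x - y‖ ^ 2) - Real.exp (-α * R ^ 2) with hh
    set f : E → ℝ := fun x => φ x - δ / 2 * h x with hf
    have hfc : ContinuousOn f (Metric.closedBall z (R / 2)) := by
      refine (hφc.mono hsub).sub (Continuous.continuousOn ?_)
      fun_prop
    obtain ⟨x, hxb, hxm⟩ := (isCompact_closedBall z (R / 2)).exists_isMinOn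
      ⟨z, Metric.mem_closedBall_self (by positivity)⟩ hfc
    have hfz : f z = μ := by
      simp only [hf, hh, hz, ← dist_eq_norm, hzy]; ring
    have hfx : f x ≤ μ := hfz ▸ hxm (Metric.mem_closedBall_self (by positivity))
    -- On the part of the sphere inside the touching ball φ exceeds μ by δ while h ≤ 1; on the rest
    -- h < 0. So f > μ = f z on the sphere and the minimum is interior, against the barrier lemma.
    have hxball : x ∈ Metric.ball z (R / 2) := by
      by_contra hxn
      have hxs : x ∈ Metric.sphere z (R / 2) := by
        rw [Metric.mem_sphere]; rw [Metric.mem_closedBall] at hxb; rw [Metric.mem_ball] at hxn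
        linarith
      by_cases hxR : x ∈ Metric.closedBall y R
      · have h1 := hδ x ⟨hxs, hxR⟩
        have h2 : h x ≤ 1 := by
          have e1 : Real.exp (-α * ‖x - y‖ ^ 2) ≤ 1 := Real.exp_le_one_iff.mpr (by
            have : 0 ≤ α * ‖x - y‖ ^ 2 := by positivity
            linarith)
          have e2 := Real.exp_pos (-α * R ^ 2)
          simp only [hh]; linarith
        have h3 : f x = φ x - δ / 2 * h x := rfl
        nlinarith
      · have h1 := hmin x (hsub hxb)
        have h2 : h x < 0 := by
          rw [Metric.mem_closedBall, not_le, dist_eq_norm] at hxR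
          have : Real.exp (-α * ‖x - y‖ ^ 2) < Real.exp (-α * R ^ 2) := by
            rw [Real.exp_lt_exp]
            have : R ^ 2 < ‖x - y‖ ^ 2 := by gcongr
            nlinarith
          simp only [hh]; linarith
        have h3 : f x = φ x - δ / 2 * h x := rfl
        nlinarith
    have hloc : IsLocalMin f x := by
      refine hxm.isLocalMin (mem_of_superset (Metric.isOpen_ball.mem_nhds hxball)
        Metric.ball_subset_closedBall)
    have hxy1 : R / 2 ≤ ‖x - y‖ := by
      rw [← dist_eq_norm]
      have := dist_triangle z x y
      rw [dist_comm z x] at this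
      rw [Metric.mem_closedBall] at hxb
      linarith
    have hxy2 : ‖x - y‖ ≤ 2 * R := by
      rw [← dist_eq_norm]
      have := dist_triangle x z y
      rw [Metric.mem_closedBall] at hxb
      linarith
    refine not_isLocalMin_sub_barrier (hφ x (hsub hxb)) (half_pos hδ0) hα0 ?_ hloc
    calc Fintype.card ι * C x * (1 + ‖x - y‖)
        ≤ Fintype.card ι * |C₀| * (1 + 2 * R) := by
          gcongr
          exact (hC₀' x hxb).trans (le_abs_self _)
      _ < 2 * α * (R / 2) ^ 2 := hα
      _ ≤ 2 * α * ‖x - y‖ ^ 2 := by gcongr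
  have hU : IsOpen (Ω ∩ {x | φ x = μ}) := by
    rw [isOpen_iff_mem_nhds]
    rintro x ⟨hx, hxμ⟩
    exact inter_mem (hΩ.mem_nhds hx) (hopen x hx hxμ)
  have hV : IsOpen (Ω ∩ {x | φ x ≠ μ}) :=
    hφc.isOpen_inter_preimage hΩ isOpen_ne
  intro x hx
  by_contra hne
  obtain ⟨x', -, h1, h2⟩ := hΩc _ _ hU hV
    (fun x hx => (em (φ x = μ)).imp (fun h => ⟨hx, h⟩) fun h => ⟨hx, h⟩)
    ⟨z₀, hz₀, hz₀, rfl⟩ ⟨x, hx, hx, hne⟩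
  exact h2.2 h1.2

end StrongMinimumPrinciple

/-! ### Derivatives of the logarithm of a determinant. -/

section LogDet

variable {J : Type*} [Fintype J] [DecidableEq J]

theorem Matrix.trace_adjugate_mul {R : Type*} [CommRing R] (M P : Matrix J J R) :
    (M.adjugate * P).trace = ∑ i, (M.updateCol i fun k => P k i).det := by
  simp only [Matrix.trace, Matrix.diag_apply, Matrix.mul_apply]
  refine Finset.sum_congr rfl fun i _ => ?_
  rw [← Matrix.cramer_apply, Matrix.cramer_eq_adjugate_mulVec]
  rfl

theorem hasDerivAt_det {M : ℝ → Matrix J J ℝ} {P : Matrix J J ℝ} {t : ℝ}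
    (h : ∀ i j, HasDerivAt (fun s => M s i j) (P i j) t) :
    HasDerivAt (fun s => (M s).det) ((M t).adjugate * P).trace t := by
  simp only [Matrix.trace_adjugate_mul, Matrix.det_apply']
  rw [Finset.sum_comm]
  refine HasDerivAt.fun_sum fun σ _ => ?_
  rw [← Finset.mul_sum]
  refine HasDerivAt.const_mul _ ?_
  refine (HasDerivAt.fun_finsetProd fun i _ => h (σ i) i).congr_deriv ?_
  refine Finset.sum_congr rfl fun i _ => ?_
  rw [smul_eq_mul, ← Finset.mul_prod_erase _ _ (Finset.mem_univ i), mul_comm]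
  congr 1
  · simp
  · refine Finset.prod_congr rfl fun j hj => ?_
    rw [Matrix.updateCol_ne (Finset.ne_of_mem_erase hj)]

/-- The entries of the inverse are quotients of determinants, hence differentiable; their
derivatives then come from differentiating M⁻¹ M = 1. -/
theorem hasDerivAt_matrix_inv_apply {M : ℝ → Matrix J J ℝ} {P : Matrix J J ℝ} {t : ℝ}
    (h : ∀ i j, HasDerivAt (fun s => M s i j) (P i j) t) (hdet : (M t).det ≠ 0) (i j : J) :
    HasDerivAt (fun s => (M s)⁻¹ i j) (-((M t)⁻¹ * P * (M t)⁻¹) i j) t := by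
  have hadj : ∀ i j, DifferentiableAt ℝ (fun s => (M s).adjugate i j) t := by
    intro i j
    simp only [Matrix.adjugate_apply]
    refine (hasDerivAt_det (P := P.updateRow j 0) (M := fun s => (M s).updateRow j (Pi.single i 1))
      fun k l => ?_).differentiableAt
    by_cases hk : k = j
    · subst hk; simpa using hasDerivAt_const t _
    · simpa [Matrix.updateRow_ne hk] using h k l
  have hinv : ∀ i j, DifferentiableAt ℝ (fun s => (M s)⁻¹ i j) t := by
    intro i j
    simp only [Matrix.inv_def, Matrix.smul_apply, Ring.inverse_eq_inv', smul_eq_mul]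
    exact ((hasDerivAt_det h).differentiableAt.inv hdet).mul (hadj i j)
  set D : Matrix J J ℝ := Matrix.of fun i j => deriv (fun s => (M s)⁻¹ i j) t with hD
  have hev : ∀ᶠ s in 𝓝 t, (M s)⁻¹ * M s = 1 := by
    filter_upwards [(hasDerivAt_det h).continuousAt.eventually_ne hdet] with s hs
    exact Matrix.nonsing_inv_mul _ (isUnit_iff_ne_zero.mpr hs)
  have hzero : D * M t + (M t)⁻¹ * P = 0 := by
    ext i j
    have h1 : HasDerivAt (fun s => ((M s)⁻¹ * M s) i j)
        ((D * M t + (M t)⁻¹ * P) i j) t := by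
      simp only [Matrix.mul_apply, Matrix.add_apply, ← Finset.sum_add_distrib]
      exact HasDerivAt.fun_sum fun k _ => (hinv i k).hasDerivAt.fun_mul (h k j)
    have h2 : HasDerivAt (fun s => ((M s)⁻¹ * M s) i j) 0 t :=
      (hasDerivAt_const t ((1 : Matrix J J ℝ) i j)).congr_of_eventuallyEq
        (hev.mono fun s hs => by simp [hs])
    exact h1.unique h2
  have hDeq : D = -((M t)⁻¹ * P * (M t)⁻¹) := by
    have h3 : D * M t * (M t)⁻¹ = -((M t)⁻¹ * P) * (M t)⁻¹ := by
      rw [eq_neg_of_add_eq_zero_left hzero]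
    rw [Matrix.mul_assoc, Matrix.mul_nonsing_inv _ (isUnit_iff_ne_zero.mpr hdet),
      Matrix.mul_one] at h3
    rw [h3, Matrix.neg_mul]
  have := (hinv i j).hasDerivAt
  rw [show deriv (fun s => (M s)⁻¹ i j) t = D i j from rfl, hDeq] at this
  exact this

/-- The second order Taylor coefficients of `log |det M|`. -/
theorem HasJet.log_det {M : ℝ → Matrix J J ℝ} {M₀ M₁ M₂ N : Matrix J J ℝ}
    (h : ∀ i j, HasJet (fun t => M t i j) (M₀ i j) (M₁ i j) (M₂ i j)) (hN : M₀ * N = 1) :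
    HasJet (fun t => Real.log (M t).det) (Real.log M₀.det) (N * M₁).trace
      ((N * M₂).trace - (N * M₁ * (N * M₁)).trace) := by
  have h0 : M 0 = M₀ := by ext i j; exact (h i j).val
  have hdet : M₀.det ≠ 0 := by
    intro h'
    have := congrArg Matrix.det hN
    simp [h'] at this
  have hNinv : M₀⁻¹ = N := Matrix.inv_eq_right_inv hN
  choose p hp hp1 hp2 using fun i j => (h i j).exists_deriv
  set P : ℝ → Matrix J J ℝ := fun t => Matrix.of fun i j => p i j t with hP
  have hP1 : P 0 = M₁ := by ext i j; exact hp1 i j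
  have hev : ∀ᶠ t in 𝓝 (0 : ℝ), ∀ i j, HasDerivAt (fun s => M s i j) (P t i j) t := by
    simp only [eventually_all]
    exact fun i j => hp i j
  have hdet0 : (M 0).det ≠ 0 := by rwa [h0]
  have hcont : ContinuousAt (fun t => (M t).det) 0 :=
    (hasDerivAt_det hev.self_of_nhds).continuousAt
  refine ⟨by rw [h0], fun t => ((M t)⁻¹ * P t).trace, ?_, by simp only [h0, hP1, hNinv], ?_⟩
  · filter_upwards [hev, hcont.eventually_ne hdet0] with t ht hd
    refine ((hasDerivAt_det ht).log hd).congr_deriv ?_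
    rw [Matrix.inv_def, Matrix.smul_mul, Matrix.trace_smul, Ring.inverse_eq_inv', smul_eq_mul,
      div_eq_inv_mul]
  · have hI := hasDerivAt_matrix_inv_apply hev.self_of_nhds hdet0
    have h1 : HasDerivAt (fun t => ((M t)⁻¹ * P t).trace)
        (-((M 0)⁻¹ * P 0 * (M 0)⁻¹) * P 0 + (M 0)⁻¹ * M₂).trace 0 := by
      simp only [Matrix.trace, Matrix.diag_apply, Matrix.mul_apply (N := P _), Matrix.add_apply,
        Matrix.mul_apply (N := M₂), ← Finset.sum_add_distrib]
      refine HasDerivAt.fun_sum fun i _ => HasDerivAt.fun_sum fun k _ => ?_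
      exact (hI i k).fun_mul (hp2 k i)
    refine h1.congr_deriv ?_
    rw [h0, hP1, hNinv, Matrix.trace_add, Matrix.neg_mul, Matrix.trace_neg,
      Matrix.mul_assoc (N * M₁)]
    ring

end LogDet

theorem Fintype.sum_sum_unit {α M : Type*} [Fintype α] [AddCommMonoid M] (f : α ⊕ Unit → M) :
    ∑ i, f i = ∑ i, f (.inl i) + f (.inr ()) := by
  simp

/-! ### The bordered Hessian and the Gaussian curvature of level sets. -/

noncomputable section BorderedHessian

variable {n m : ℕ}

/-- The bordered Hessian form on `ℝⁿ × ℝ` of a function with gradient `g` and Hessian `A`. -/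
def borderedForm (g : Euc n) (A : Euc n →L[ℝ] Euc n) : LinearMap.BilinForm ℝ (Euc n × ℝ) :=
  LinearMap.mk₂ ℝ
    (fun v w => inner ℝ v.1 (A w.1) + v.2 * inner ℝ g w.1 + w.2 * inner ℝ g v.1)
    (fun v v' w => by simp [inner_add_left, inner_add_right]; ring)
    (fun c v w => by simp [inner_smul_left, inner_smul_right]; ring)
    (fun v w w' => by simp [inner_add_right]; ring)
    (fun c v w => by simp [inner_smul_right]; ring)

theorem borderedForm_apply (g : Euc n) (A : Euc n →L[ℝ] Euc n) (v w : Euc n × ℝ) :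
    borderedForm g A v w
      = inner ℝ v.1 (A w.1) + v.2 * inner ℝ g w.1 + w.2 * inner ℝ g v.1 := rfl

/-- The matrix of the bordered Hessian form in a family of vectors. -/
def borderedGram {J : Type*} (P : J → Euc n × ℝ) (g : Euc n) (A : Euc n →L[ℝ] Euc n) :
    Matrix J J ℝ :=
  Matrix.of fun i j => borderedForm g A (P i) (P j)

/-- The frame of `ℝⁿ × ℝ` made of an orthonormal basis of `ℝⁿ` and the vector `(0, 1)`. -/
def prodFrame (e : OrthonormalBasis (Fin m ⊕ Unit) ℝ (Euc n)) : Fin m ⊕ Fin 2 → Euc n × ℝ :=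
  Sum.elim (fun i => (e (.inl i), 0)) ![(e (.inr ()), 0), (0, 1)]

/-- The coordinates of a family of vectors of `ℝⁿ × ℝ` in `prodFrame e`. -/
def frameCoords (e : OrthonormalBasis (Fin m ⊕ Unit) ℝ (Euc n)) {J : Type*}
    (P : J → Euc n × ℝ) : Matrix (Fin m ⊕ Fin 2) J ℝ :=
  Matrix.of fun i j => Sum.elim (fun i => inner ℝ (e (.inl i)) (P j).1)
    ![inner ℝ (e (.inr ())) (P j).1, (P j).2] i

theorem sum_frameCoords_smul (e : OrthonormalBasis (Fin m ⊕ Unit) ℝ (Euc n)) {J : Type*}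
    (P : J → Euc n × ℝ) (j : J) : ∑ i, frameCoords e P i j • prodFrame e i = P j := by
  have h := e.sum_repr' (P j).1
  rw [Fintype.sum_sum_unit] at h
  rw [Fintype.sum_sum_type, Fin.sum_univ_two]
  ext1
  · simp only [frameCoords, prodFrame, Matrix.of_apply, Sum.elim_inl, Sum.elim_inr, Prod.fst_add,
      Prod.fst_sum, Prod.smul_fst, Matrix.cons_val_zero, Matrix.cons_val_one, smul_zero, add_zero]
    exact h
  · simp [frameCoords, prodFrame, Prod.snd_sum]

theorem borderedGram_eq (e : OrthonormalBasis (Fin m ⊕ Unit) ℝ (Euc n)) {J : Type*}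
    (P : J → Euc n × ℝ) (g : Euc n) (A : Euc n →L[ℝ] Euc n) :
    borderedGram P g A
      = (frameCoords e P).transpose * borderedGram (prodFrame e) g A * frameCoords e P := by
  ext i j
  rw [Matrix.mul_assoc]
  simp only [borderedGram, Matrix.of_apply, Matrix.mul_apply, Matrix.transpose_apply]
  conv_lhs => rw [← sum_frameCoords_smul e P i, ← sum_frameCoords_smul e P j]
  simp only [map_sum, LinearMap.sum_apply, map_smul, LinearMap.smul_apply, smul_eq_mul,
    Finset.mul_sum]
  rw [Finset.sum_comm]
  refine Finset.sum_congr rfl fun k _ => Finset.sum_congr rfl fun l _ => ?_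
  ring

theorem frameCoords_prodFrame_orthogonal (e e' : OrthonormalBasis (Fin m ⊕ Unit) ℝ (Euc n)) :
    (frameCoords e (prodFrame e')).transpose * frameCoords e (prodFrame e') = 1 := by
  have h : ∀ x y : Euc n, (∑ i : Fin m, inner ℝ (e (.inl i)) x * inner ℝ (e (.inl i)) y)
      + inner ℝ (e (.inr ())) x * inner ℝ (e (.inr ())) y = inner ℝ x y := by
    intro x y
    have := e.sum_inner_mul_inner x y
    rw [Fintype.sum_sum_unit] at this
    rw [← this]
    congr 1
    · exact Finset.sum_congr rfl fun i _ => by rw [real_inner_comm x]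
    · rw [real_inner_comm x]
  have ho := orthonormal_iff_ite.mp e'.orthonormal
  ext i j
  rw [Matrix.mul_apply, Fintype.sum_sum_type, Fin.sum_univ_two]
  simp only [frameCoords, Matrix.transpose_apply, Matrix.of_apply, Sum.elim_inl, Sum.elim_inr,
    Matrix.cons_val_zero, Matrix.cons_val_one, ← add_assoc, h]
  rcases i with i | i <;> rcases j with j | j
  · simp [prodFrame, ho, Matrix.one_apply]
  · fin_cases j <;> simp [prodFrame, ho]
  · fin_cases i <;> simp [prodFrame, ho]
  · fin_cases i <;> fin_cases j <;> simp [prodFrame]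

/-- The change between the two frames is orthogonal, so its determinant has square 1. This allows
the adapted frame to depend on `g` while the determinant is computed in a fixed one. -/
theorem det_borderedGram_prodFrame_eq (e e' : OrthonormalBasis (Fin m ⊕ Unit) ℝ (Euc n))
    (g : Euc n) (A : Euc n →L[ℝ] Euc n) :
    (borderedGram (prodFrame e') g A).det = (borderedGram (prodFrame e) g A).det := by
  have h := congrArg Matrix.det (frameCoords_prodFrame_orthogonal e e')
  rw [Matrix.det_mul, Matrix.det_one] at h
  rw [borderedGram_eq e, Matrix.det_mul, Matrix.det_mul]
  linear_combination (borderedGram (prodFrame e) g A).det * h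

/-- An orthonormal basis of a hyperplane, completed by the unit normal. -/
theorem exists_adapted_orthonormalBasis {g : Euc n} (hg : g ≠ 0)
    (b : OrthonormalBasis (Fin m) ℝ (ℝ ∙ g)ᗮ) :
    ∃ e : OrthonormalBasis (Fin m ⊕ Unit) ℝ (Euc n),
      (∀ i, e (.inl i) = b i) ∧ e (.inr ()) = ‖g‖⁻¹ • g := by
  have hn : ‖g‖ ≠ 0 := norm_ne_zero_iff.mpr hg
  set v : Fin m ⊕ Unit → Euc n := Sum.elim (fun i => (b i : Euc n)) fun _ => ‖g‖⁻¹ • g with hv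
  have hperp : ∀ i, inner ℝ (b i : Euc n) g = 0 := fun i =>
    Submodule.mem_orthogonal_singleton_iff_inner_left.mp (b i).2
  have hperp' : ∀ i, inner ℝ g (b i : Euc n) = 0 := fun i =>
    Submodule.mem_orthogonal_singleton_iff_inner_right.mp (b i).2
  have hb := orthonormal_iff_ite.mp b.orthonormal
  have ho : Orthonormal ℝ v := by
    rw [orthonormal_iff_ite]
    rintro (i | i) (j | j)
    · have := hb i j
      rw [Submodule.coe_inner] at this
      simp [hv, this]
    · simp [hv, inner_smul_right, hperp]
    · simp [hv, inner_smul_left, hperp']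
    · simp [hv, norm_smul, hn]
  have hcard : Fintype.card (Fin m ⊕ Unit) = Module.finrank ℝ (Euc n) := by
    have h1 := Module.finrank_eq_card_basis b.toBasis
    have h2 := (ℝ ∙ g).finrank_add_finrank_orthogonal
    rw [finrank_span_singleton hg, h1] at h2
    rw [← h2]; simp [add_comm]
  obtain ⟨e, he⟩ := Orthonormal.exists_orthonormalBasis_extension_of_card_eq (s := univ)
    hcard.symm (v := v) (ho.comp _ Subtype.val_injective)
  exact ⟨e, fun i => he _ (mem_univ _), he _ (mem_univ _)⟩

theorem levelGaussCurv_eq_det (g : Euc n) (A : Euc n →L[ℝ] Euc n)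
    (b : OrthonormalBasis (Fin m) ℝ (ℝ ∙ g)ᗮ) :
    levelGaussCurv g A
      = (-‖g‖⁻¹) ^ m * (Matrix.of fun i j => inner ℝ (b i : Euc n) (A (b j))).det := by
  have h : LinearMap.toMatrix b.toBasis b.toBasis (levelShapeOp g A)
      = (-‖g‖⁻¹) • (Matrix.of fun i j => inner ℝ (b i : Euc n) (A (b j))) := by
    ext i j
    rw [LinearMap.toMatrix_apply, Matrix.smul_apply, Matrix.of_apply, b.coe_toBasis,
      b.coe_toBasis_repr_apply, b.repr_apply_apply, levelShapeOp, LinearMap.smul_apply,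
      inner_smul_right, smul_eq_mul]
    congr 1
    exact Submodule.inner_orthogonalProjectionOnto_eq_of_mem_left _ _
  rw [levelGaussCurv, ← LinearMap.det_toMatrix b.toBasis, h, Matrix.det_smul, Fintype.card_fin]

/-- Schur complement of the corner `D` spanned by ν and the border. The inverse of `D` vanishes in
the entry where `B` and `C` could contribute, so the correction is zero and the determinant is det
`D` = -|g|² times the tangential one. -/
theorem det_borderedGram_adapted {g : Euc n} (hg : g ≠ 0) (A : Euc n →L[ℝ] Euc n)
    (b : OrthonormalBasis (Fin m) ℝ (ℝ ∙ g)ᗮ)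
    {e : OrthonormalBasis (Fin m ⊕ Unit) ℝ (Euc n)} (he : ∀ i, e (.inl i) = b i)
    (hν : e (.inr ()) = ‖g‖⁻¹ • g) :
    (borderedGram (prodFrame e) g A).det = -(-1) ^ m * (‖g‖ ^ (m + 2) * levelGaussCurv g A) := by
  have hn : ‖g‖ ≠ 0 := norm_ne_zero_iff.mpr hg
  have hperp : ∀ i, inner ℝ g (b i : Euc n) = 0 := fun i =>
    Submodule.mem_orthogonal_singleton_iff_inner_right.mp (b i).2
  set A' : Matrix (Fin m) (Fin m) ℝ := Matrix.of fun i j => inner ℝ (b i : Euc n) (A (b j))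
  set c := inner ℝ (e (.inr ())) (A (e (.inr ())))
  set B : Matrix (Fin m) (Fin 2) ℝ := Matrix.of fun i j => ![inner ℝ (b i : Euc n) (A (e (.inr ()))), 0] j
  set C : Matrix (Fin 2) (Fin m) ℝ := Matrix.of fun i j => ![inner ℝ (e (.inr ())) (A (b j)), 0] i
  set D : Matrix (Fin 2) (Fin 2) ℝ := !![c, ‖g‖; ‖g‖, 0]
  set D' : Matrix (Fin 2) (Fin 2) ℝ := !![0, ‖g‖⁻¹; ‖g‖⁻¹, -c * ‖g‖⁻¹ ^ 2]
  have hblock : borderedGram (prodFrame e) g A = Matrix.fromBlocks A' B C D := by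
    have hgν : inner ℝ g (e (.inr ())) = ‖g‖ := by
      rw [hν, inner_smul_right, real_inner_self_eq_norm_sq]; field_simp
    ext i j
    rcases i with i | i <;> rcases j with j | j
    · simp [borderedGram, borderedForm_apply, prodFrame, he, A']
    · fin_cases j <;> simp [borderedGram, borderedForm_apply, prodFrame, he, B, hperp]
    · fin_cases i <;> simp [borderedGram, borderedForm_apply, prodFrame, he, C, hperp]
    · fin_cases i <;> fin_cases j <;>
        simp [borderedGram, borderedForm_apply, prodFrame, D, hgν, c]
  have hDD : D * D' = 1 := by
    ext i j
    fin_cases i <;> fin_cases j <;> simp [D, D', Matrix.mul_apply, Fin.sum_univ_two, hn]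
    field_simp; ring
  have hD'D : D' * D = 1 := mul_eq_one_comm.mp hDD
  let _ : Invertible D := ⟨D', hD'D, hDD⟩
  have hz : B * ⅟D * C = 0 := by
    change B * D' * C = 0
    ext i j
    simp [B, C, D', Matrix.mul_apply, Fin.sum_univ_two]
  rw [hblock, Matrix.det_fromBlocks₂₂, hz, sub_zero, levelGaussCurv_eq_det g A b]
  have hdD : D.det = -‖g‖ ^ 2 := by simp [D, Matrix.det_fin_two]; ring
  have h1 : (-1 : ℝ) ^ m * (‖g‖ ^ (m + 2) * (-‖g‖⁻¹) ^ m) = ‖g‖ ^ 2 := by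
    rw [pow_add, neg_eq_neg_one_mul ‖g‖⁻¹, mul_pow, inv_pow]
    have h2 : (-1 : ℝ) ^ m * (-1) ^ m = 1 := by rw [← mul_pow]; simp
    field_simp
    linear_combination h2
  rw [hdD]
  linear_combination A'.det * h1

/-- In a fixed frame of `ℝⁿ × ℝ`, the bordered Hessian determinant is a constant multiple of
`|g|^(n+1) K`. -/
theorem exists_det_borderedGram_eq (hn : n = m + 1)
    (e : OrthonormalBasis (Fin m ⊕ Unit) ℝ (Euc n)) (P : Fin m ⊕ Fin 2 → Euc n × ℝ) :
    ∃ c : ℝ, ∀ (g : Euc n) (A : Euc n →L[ℝ] Euc n), g ≠ 0 →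
      (borderedGram P g A).det = c * (‖g‖ ^ (m + 2) * levelGaussCurv g A) := by
  refine ⟨(frameCoords e P).det ^ 2 * -(-1) ^ m, fun g A hg => ?_⟩
  have : Fact (Module.finrank ℝ (Euc n) = m + 1) := ⟨by simp [hn]⟩
  have hfr : Module.finrank ℝ (ℝ ∙ g)ᗮ = m := Submodule.finrank_orthogonal_span_singleton hg
  obtain ⟨e', he', hν'⟩ := exists_adapted_orthonormalBasis hg
    ((stdOrthonormalBasis ℝ (ℝ ∙ g)ᗮ).reindex (finCongr hfr))
  rw [borderedGram_eq e, Matrix.det_mul, Matrix.det_mul, Matrix.det_transpose,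
    ← det_borderedGram_prodFrame_eq e e', det_borderedGram_adapted hg A _ he' hν']
  ring

end BorderedHessian

/-! ### Iterated directional derivatives and their symmetry. -/

noncomputable section DirectionalDerivatives

variable {E : Type*} [NormedAddCommGroup E] [NormedSpace ℝ E]

/-- The derivative of `f` in the direction `v`. -/
def dirDeriv (v : E) (f : E → ℝ) (x : E) : ℝ := fderiv ℝ f x v

theorem ContDiffOn.dirDeriv {f : E → ℝ} {Ω : Set E} {j k : WithTop ℕ∞} (hf : ContDiffOn ℝ k f Ω)
    (hΩ : IsOpen Ω) (hjk : j + 1 ≤ k) (v : E) : ContDiffOn ℝ j (dirDeriv v f) Ω :=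
  (hf.fderiv_of_isOpen hΩ hjk).clm_apply contDiffOn_const

theorem dirDeriv_congr {f g : E → ℝ} {Ω : Set E} (hΩ : IsOpen Ω) (h : EqOn f g Ω) (v : E) {x : E}
    (hx : x ∈ Ω) : dirDeriv v f x = dirDeriv v g x := by
  rw [dirDeriv, dirDeriv, (h.eventuallyEq_of_mem (hΩ.mem_nhds hx)).fderiv_eq]

theorem dirDeriv_comm {f : E → ℝ} {Ω : Set E} (hΩ : IsOpen Ω) (hf : ContDiffOn ℝ 2 f Ω) (v w : E)
    {x : E} (hx : x ∈ Ω) : dirDeriv v (dirDeriv w f) x = dirDeriv w (dirDeriv v f) x := by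
  have hfx := hf.contDiffAt (hΩ.mem_nhds hx)
  have hd : DifferentiableAt ℝ (fderiv ℝ f) x :=
    (hfx.fderiv_right (m := 1) (by norm_num)).differentiableAt (by norm_num)
  have h : ∀ v w : E, dirDeriv v (dirDeriv w f) x = fderiv ℝ (fderiv ℝ f) x v w := by
    intro v w
    have : HasFDerivAt (fun y => fderiv ℝ f y w) ((fderiv ℝ (fderiv ℝ f) x).flip w) x := by
      simpa using hd.hasFDerivAt.clm_apply (hasFDerivAt_const w x)
    exact congrArg (fun L => L v) this.fderiv
  rw [h, h]
  exact (hfx.isSymmSndFDerivAt (by simp)).eq v w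

theorem hasDerivAt_dirDeriv {f : E → ℝ} {x v : E} {t : ℝ}
    (hf : DifferentiableAt ℝ f (x + t • v)) :
    HasDerivAt (fun s : ℝ => f (x + s • v)) (dirDeriv v f (x + t • v)) t := by
  have h1 : HasDerivAt (fun s : ℝ => x + s • v) v t := by
    simpa using ((hasDerivAt_id t).smul_const v).const_add x
  exact hf.hasFDerivAt.comp_hasDerivAt t h1

theorem eventually_line_mem {Ω : Set E} (hΩ : IsOpen Ω) {x : E} (hx : x ∈ Ω) (v : E) :
    ∀ᶠ t : ℝ in 𝓝 0, x + t • v ∈ Ω := by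
  have hc : ContinuousAt (fun t : ℝ => x + t • v) 0 := by fun_prop
  exact hc.eventually_mem (by simpa using hΩ.mem_nhds hx)

theorem hasJet_line {f : E → ℝ} {Ω : Set E} (hΩ : IsOpen Ω) (hf : ContDiffOn ℝ 2 f Ω) (v : E)
    {x : E} (hx : x ∈ Ω) :
    HasJet (fun t => f (x + t • v)) (f x) (dirDeriv v f x) (dirDeriv v (dirDeriv v f) x) := by
  have hd : ∀ y ∈ Ω, DifferentiableAt ℝ f y := fun y hy =>
    (hf.contDiffAt (hΩ.mem_nhds hy)).differentiableAt (by norm_num)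
  have hd' : DifferentiableAt ℝ (dirDeriv v f) x :=
    ((hf.dirDeriv hΩ (j := 1) (by norm_num) v).contDiffAt (hΩ.mem_nhds hx)).differentiableAt
      (by norm_num)
  refine ⟨by simp, fun t => dirDeriv v f (x + t • v), ?_, by simp, ?_⟩
  · filter_upwards [eventually_line_mem hΩ hx v] with t ht using hasDerivAt_dirDeriv (hd _ ht)
  · have := hasDerivAt_dirDeriv (f := dirDeriv v f) (x := x) (v := v) (t := 0) (by simpa using hd')
    simpa using this

end DirectionalDerivatives

/-! ### The minimal surface equation in non-divergence form. -/

section MinimalSurfaceEquation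

variable {n : ℕ} {u : Euc n → ℝ} {Ω : Set (Euc n)}

theorem inner_gradient_eq_dirDeriv (u : Euc n → ℝ) (x v : Euc n) :
    inner ℝ v (∇ u x) = dirDeriv v u x := by
  rw [real_inner_comm, dirDeriv, gradient, InnerProductSpace.toDual_symm_apply]

theorem ContDiffOn.gradient {k j : WithTop ℕ∞} (hu : ContDiffOn ℝ k u Ω) (hΩ : IsOpen Ω)
    (hjk : j + 1 ≤ k) : ContDiffOn ℝ j (∇ u) Ω :=
  (InnerProductSpace.toDual ℝ (Euc n)).symm.contDiff.comp_contDiffOn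
    (hu.fderiv_of_isOpen hΩ hjk)

theorem hasFDerivAt_gradient (hΩ : IsOpen Ω) (hu : ContDiffOn ℝ 2 u Ω) {x : Euc n} (hx : x ∈ Ω) :
    HasFDerivAt (∇ u) (hessianOp u x) x :=
  (((hu.gradient hΩ (j := 1) (by norm_num)).contDiffAt (hΩ.mem_nhds hx)).differentiableAt
    (by norm_num)).hasFDerivAt

theorem inner_hessianOp_eq_dirDeriv (hΩ : IsOpen Ω) (hu : ContDiffOn ℝ 2 u Ω) {x : Euc n}
    (hx : x ∈ Ω) (v w : Euc n) :
    inner ℝ v (hessianOp u x w) = dirDeriv w (dirDeriv v u) x := by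
  have h : dirDeriv v u = fun y => inner ℝ v (∇ u y) :=
    funext fun y => (inner_gradient_eq_dirDeriv u y v).symm
  have h' := (innerSL ℝ v).hasFDerivAt.comp x (hasFDerivAt_gradient hΩ hu hx)
  rw [h, dirDeriv]
  exact (congrArg (fun L => L w) h'.fderiv).symm

theorem inner_hessianOp_symm (hΩ : IsOpen Ω) (hu : ContDiffOn ℝ 2 u Ω) {x : Euc n}
    (hx : x ∈ Ω) (v w : Euc n) :
    inner ℝ v (hessianOp u x w) = inner ℝ w (hessianOp u x v) := by
  rw [inner_hessianOp_eq_dirDeriv hΩ hu hx, inner_hessianOp_eq_dirDeriv hΩ hu hx,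
    dirDeriv_comm hΩ hu _ _ hx]

/-- The minimal surface equation in non-divergence form, in an orthonormal basis. -/
theorem SolvesMinimalSurfaceEq.nondivergence (hmin : SolvesMinimalSurfaceEq Ω u) (hΩ : IsOpen Ω)
    (hu : ContDiffOn ℝ 2 u Ω) {ι : Type*} [Fintype ι] (e : OrthonormalBasis ι ℝ (Euc n))
    {x : Euc n} (hx : x ∈ Ω) :
    (1 + ∑ i, dirDeriv (e i) u x * dirDeriv (e i) u x)
        * ∑ i, dirDeriv (e i) (dirDeriv (e i) u) x
      - ∑ i, ∑ j, dirDeriv (e i) u x * dirDeriv (e j) u x * dirDeriv (e j) (dirDeriv (e i) u) x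
      = 0 := by
  have hA := hasFDerivAt_gradient hΩ hu hx
  set A := hessianOp u x
  set r : ℝ := 1 + ‖∇ u x‖ ^ 2 with hr
  have hr0 : 0 < r := by positivity
  have hs0 : 0 < Real.sqrt r := Real.sqrt_pos.mpr hr0
  have hss : Real.sqrt r ^ 2 = r := Real.sq_sqrt hr0.le
  have h1 := ((hA.norm_sq.const_add 1).sqrt hr0.ne')
  have h2 := (hasDerivAt_inv hs0.ne').comp_hasFDerivAt x h1
  have h3 : HasFDerivAt (fun y => (Real.sqrt (1 + ‖∇ u y‖ ^ 2))⁻¹ • ∇ u y) _ x := h2.smul hA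
  have h4 := hmin x hx
  rw [divergence, h3.fderiv, LinearMap.trace_eq_sum_inner _ e] at h4
  have hterm : ∀ i, dirDeriv (e i) (dirDeriv (e i) u) x = inner ℝ (e i) (A (e i)) := fun i =>
    (inner_hessianOp_eq_dirDeriv hΩ hu hx _ _).symm
  have hexp : ∀ j, inner ℝ (∇ u x) (A (e j))
      = ∑ i, dirDeriv (e i) u x * dirDeriv (e j) (dirDeriv (e i) u) x := by
    intro j
    rw [← e.sum_inner_mul_inner]
    refine Finset.sum_congr rfl fun i _ => ?_
    rw [real_inner_comm, inner_gradient_eq_dirDeriv, inner_hessianOp_eq_dirDeriv hΩ hu hx]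
  have hnorm : ∑ i, dirDeriv (e i) u x * dirDeriv (e i) u x = ‖∇ u x‖ ^ 2 := by
    rw [← real_inner_self_eq_norm_sq, ← e.sum_inner_mul_inner]
    refine Finset.sum_congr rfl fun i _ => ?_
    rw [real_inner_comm, inner_gradient_eq_dirDeriv]
  have hdouble : ∑ i, ∑ j,
      dirDeriv (e i) u x * dirDeriv (e j) u x * dirDeriv (e j) (dirDeriv (e i) u) x
      = ∑ j, dirDeriv (e j) u x * inner ℝ (∇ u x) (A (e j)) := by
    rw [Finset.sum_comm]
    refine Finset.sum_congr rfl fun j _ => ?_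
    rw [hexp, Finset.mul_sum]
    exact Finset.sum_congr rfl fun i _ => by ring
  rw [hnorm, hdouble, ← hr]
  simp only [hterm]
  -- The product rule for r^(-1/2) ∇u with r = 1 + |∇u|²; after summation over i, multiplication by
  -- r^(3/2) gives r tr A - ⟨∇u, A ∇u⟩ = 0.
  have h5 : ∀ i, inner ℝ (e i) (((√(1 + ‖∇ u x‖ ^ 2))⁻¹ • A +
      ((-((√(1 + ‖∇ u x‖ ^ 2)) ^ 2)⁻¹) • (1 / (2 * √(1 + ‖∇ u x‖ ^ 2))) •
        2 • (innerSL ℝ (∇ u x)).comp A).smulRight (∇ u x)) (e i))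
      = (√r)⁻¹ * inner ℝ (e i) (A (e i))
        - (√r)⁻¹ ^ 3 * (dirDeriv (e i) u x * inner ℝ (∇ u x) (A (e i))) := by
    intro i
    simp only [_root_.add_apply, _root_.smul_apply,
      ContinuousLinearMap.smulRight_apply, ContinuousLinearMap.comp_apply, innerSL_apply_apply,
      inner_add_right, inner_smul_right, smul_eq_mul, nsmul_eq_mul, inner_gradient_eq_dirDeriv,
      ← hr]
    field_simp
    ring
  have h6 : ∑ i, ((√r)⁻¹ * inner ℝ (e i) (A (e i))
        - (√r)⁻¹ ^ 3 * (dirDeriv (e i) u x * inner ℝ (∇ u x) (A (e i)))) = 0 := by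
    rw [← h4]
    exact Finset.sum_congr rfl fun i _ => (h5 i).symm
  rw [Finset.sum_sub_distrib, ← Finset.mul_sum, ← Finset.mul_sum] at h6
  rw [← hss]
  generalize ∑ i, inner ℝ (e i) (A (e i)) = p at h6 ⊢
  generalize ∑ i, dirDeriv (e i) u x * inner ℝ (∇ u x) (A (e i)) = q at h6 ⊢
  field_simp at h6
  linarith

end MinimalSurfaceEquation

/-! ### Differentiating the equation along a line. -/

section EquationJets

variable {ι : Type*} [Fintype ι]

/-- The first two derivatives along a line of the minimal surface equation, in a frame whose vector
`ν` is directed along the gradient. -/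
theorem minimalSurface_jets [DecidableEq ι] {g : ι → ℝ → ℝ} {A : ι → ι → ℝ → ℝ} {g₁ g₂ : ι → ℝ}
    {A₀ A₁ A₂ : ι → ι → ℝ} {s : ℝ} {ν : ι}
    (hg : ∀ i, HasJet (g i) (if i = ν then s else 0) (g₁ i) (g₂ i))
    (hA : ∀ i j, HasJet (A i j) (A₀ i j) (A₁ i j) (A₂ i j))
    (hA₀ : ∀ i j, A₀ i j = A₀ j i) (hA₁ : ∀ i j, A₁ i j = A₁ j i)
    (hE : ∀ᶠ t in 𝓝 0, (1 + ∑ i, g i t * g i t) * ∑ i, A i i t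
      - ∑ i, ∑ j, g i t * g j t * A i j t = 0) :
    (2 * s * g₁ ν * ∑ i, A₀ i i + (1 + s ^ 2) * ∑ i, A₁ i i - 2 * s * ∑ i, g₁ i * A₀ i ν
        - s ^ 2 * A₁ ν ν = 0) ∧
    (2 * (s * g₂ ν + ∑ i, g₁ i ^ 2) * ∑ i, A₀ i i + 4 * s * g₁ ν * ∑ i, A₁ i i
        + (1 + s ^ 2) * ∑ i, A₂ i i - 2 * s * ∑ i, g₂ i * A₀ i ν
        - 2 * ∑ i, ∑ j, g₁ i * g₁ j * A₀ i j - 4 * s * ∑ i, g₁ i * A₁ i ν - s ^ 2 * A₂ ν ν = 0) := by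
  have h := ((((HasJet.const 1).add (HasJet.sum Finset.univ fun i _ => (hg i).mul (hg i))).mul
    (HasJet.sum Finset.univ fun i _ => hA i i)).sub (HasJet.sum Finset.univ fun i _ =>
      HasJet.sum Finset.univ fun j _ => ((hg i).mul (hg j)).mul (hA i j)))
  -- The jet computed by the product rule equals the jet of the zero function. What follows only
  -- contracts sums with the gradient, which is s times the vector of index ν.
  obtain ⟨h1, h2⟩ := h.unique ((HasJet.const 0).congr_of_eventuallyEq hE)
  set δ : ι → ℝ := fun i => if i = ν then s else 0 with hδ
  have d0 : ∀ f : ι → ℝ, ∑ i, δ i * f i = s * f ν := fun f => by simp [hδ]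
  have d1 : ∀ (f : ι → ℝ) (B : ι → ι → ℝ),
      ∑ i, ∑ j, f i * δ j * B i j = s * ∑ i, f i * B i ν := fun f B => by
    rw [Finset.mul_sum]
    refine Finset.sum_congr rfl fun i _ => ?_
    rw [Finset.sum_congr rfl fun j _ => (show f i * δ j * B i j = δ j * (f i * B i j) by ring), d0]
  have d2 : ∀ (f : ι → ℝ) (B : ι → ι → ℝ), (∀ i j, B i j = B j i) →
      ∑ i, ∑ j, δ i * f j * B i j = s * ∑ i, f i * B i ν := fun f B hB => by
    rw [Finset.sum_comm, ← d1]
    exact Finset.sum_congr rfl fun i _ => Finset.sum_congr rfl fun j _ => by rw [hB j i]; ring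
  have d3 : ∀ B : ι → ι → ℝ, ∑ i, ∑ j, δ i * δ j * B i j = s ^ 2 * B ν ν := fun B => by
    rw [d1, d0]; ring
  have S1 : ∑ i, δ i * δ i = s ^ 2 := by rw [d0]; simp [hδ]; ring
  have S2 : ∑ i, (g₁ i * δ i + δ i * g₁ i) = 2 * s * g₁ ν := by
    rw [Finset.sum_congr rfl fun i _ => (show g₁ i * δ i + δ i * g₁ i = δ i * (2 * g₁ i) by ring),
      d0]; ring
  have S3 : ∑ i, (g₂ i * δ i + 2 * (g₁ i * g₁ i) + δ i * g₂ i)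
      = 2 * (s * g₂ ν + ∑ i, g₁ i ^ 2) := by
    rw [Finset.sum_congr rfl fun i _ => (show g₂ i * δ i + 2 * (g₁ i * g₁ i) + δ i * g₂ i
      = δ i * (2 * g₂ i) + 2 * g₁ i ^ 2 by ring), Finset.sum_add_distrib, d0, ← Finset.mul_sum]
    ring
  have D1 : ∑ i, ∑ j, ((g₁ i * δ j + δ i * g₁ j) * A₀ i j + δ i * δ j * A₁ i j)
      = 2 * s * ∑ i, g₁ i * A₀ i ν + s ^ 2 * A₁ ν ν := by
    simp only [add_mul, Finset.sum_add_distrib]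
    rw [d1, d2 _ _ hA₀, d3]; ring
  have D2 : ∑ i, ∑ j, ((g₂ i * δ j + 2 * (g₁ i * g₁ j) + δ i * g₂ j) * A₀ i j
        + 2 * ((g₁ i * δ j + δ i * g₁ j) * A₁ i j) + δ i * δ j * A₂ i j)
      = 2 * s * ∑ i, g₂ i * A₀ i ν + 2 * ∑ i, ∑ j, g₁ i * g₁ j * A₀ i j
        + 4 * s * ∑ i, g₁ i * A₁ i ν + s ^ 2 * A₂ ν ν := by
    have d4 : ∑ i, ∑ j, 2 * (g₁ i * g₁ j) * A₀ i j = 2 * ∑ i, ∑ j, g₁ i * g₁ j * A₀ i j := by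
      simp only [Finset.mul_sum, mul_assoc]
    simp only [add_mul, mul_add, Finset.sum_add_distrib]
    simp only [← Finset.mul_sum]
    rw [d1, d2 _ _ hA₀, d3, d1, d2 _ _ hA₁, d4]; ring
  rw [S1, S2, D1] at h1
  rw [S1, S2, S3, D2] at h2
  exact ⟨by linarith, by linarith⟩

end EquationJets

/-! ### Traces for a block diagonal inverse of the bordered Hessian. -/

section BlockTraces

variable {m : ℕ}

/-- The left factor has the shape of the inverse bordered matrix at the point, the right one that of
its derivatives: the last corner entry is 0 because the border corner is constant. The entry `p`,
which carries the normal-normal derivatives, drops out of this trace and of the next. -/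
theorem trace_blockDiagonal_mul (d : Fin m → ℝ) (r : ℝ) (S : Matrix (Fin m) (Fin m) ℝ)
    (x y : Fin m → ℝ) (p q : ℝ) :
    (Matrix.fromBlocks (Matrix.diagonal d) 0 0 !![0, r; r, 0] *
      Matrix.fromBlocks S (Matrix.of fun i b => ![x i, y i] b)
        (Matrix.of fun b i => ![x i, y i] b) !![p, q; q, 0]).trace
      = ∑ i, d i * S i i + 2 * r * q := by
  rw [Matrix.fromBlocks_multiply]
  simp [Matrix.trace, Fin.sum_univ_two, Fintype.sum_sum_type]
  ring

theorem trace_blockDiagonal_mul_sq (d : Fin m → ℝ) (r : ℝ) (S : Matrix (Fin m) (Fin m) ℝ)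
    (hS : ∀ i j, S i j = S j i) (x y : Fin m → ℝ) (p q : ℝ) :
    (Matrix.fromBlocks (Matrix.diagonal d) 0 0 !![0, r; r, 0] *
      Matrix.fromBlocks S (Matrix.of fun i b => ![x i, y i] b)
        (Matrix.of fun b i => ![x i, y i] b) !![p, q; q, 0] *
      (Matrix.fromBlocks (Matrix.diagonal d) 0 0 !![0, r; r, 0] *
      Matrix.fromBlocks S (Matrix.of fun i b => ![x i, y i] b)
        (Matrix.of fun b i => ![x i, y i] b) !![p, q; q, 0])).trace
      = ∑ i, ∑ j, d i * d j * S i j ^ 2 + 4 * r * ∑ i, d i * (x i * y i) + 2 * (r * q) ^ 2 := by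
  have hN : Matrix.fromBlocks (Matrix.diagonal d) 0 0 !![0, r; r, 0] *
      Matrix.fromBlocks S (Matrix.of fun i b => ![x i, y i] b)
        (Matrix.of fun b i => ![x i, y i] b) !![p, q; q, 0]
      = Matrix.fromBlocks (Matrix.of fun i j => d i * S i j)
          (Matrix.of fun i b => ![d i * x i, d i * y i] b)
          (Matrix.of fun b i => ![r * y i, r * x i] b) !![r * q, 0; r * p, r * q] := by
    rw [Matrix.fromBlocks_multiply]
    congr 1
    · ext i j; simp
    · ext i b; fin_cases b <;> simp
    · ext b i; fin_cases b <;> simp [Matrix.vecHead, Matrix.vecTail]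
    · simp
  rw [hN, Matrix.fromBlocks_multiply]
  simp only [Matrix.trace, Matrix.diag_apply, Fintype.sum_sum_type, Matrix.fromBlocks_apply₁₁,
    Matrix.fromBlocks_apply₂₂, Matrix.add_apply, Matrix.mul_apply, Fin.sum_univ_two,
    Matrix.of_apply, Matrix.cons_val', Matrix.cons_val_zero, Matrix.cons_val_one,
    Matrix.cons_val_fin_one, zero_mul, mul_zero, add_zero, Finset.sum_add_distrib]
  have h1 : ∑ i, ∑ j, d i * S i j * (d j * S j i) = ∑ i, ∑ j, d i * d j * S i j ^ 2 :=
    Finset.sum_congr rfl fun i _ => Finset.sum_congr rfl fun j _ => by rw [hS j i]; ring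
  have h2 : ∀ a : Fin m → ℝ, (∀ i, a i = r * (d i * (x i * y i))) →
      ∑ i, a i = r * ∑ i, d i * (x i * y i) := fun a h => by
    rw [Finset.mul_sum]; exact Finset.sum_congr rfl fun i _ => h i
  rw [h1, h2 (fun i => d i * x i * (r * y i)) fun i => by ring,
    h2 (fun i => d i * y i * (r * x i)) fun i => by ring,
    h2 (fun i => r * y i * (d i * x i)) fun i => by ring,
    h2 (fun i => r * x i * (d i * y i)) fun i => by ring]
  ring

end BlockTraces

/-! ### Derivatives of a solution at one point and the equations they satisfy. -/

/-- The derivatives up to order four, at one point, of a solution of the minimal surface equation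
with strictly convex level sets. The frame consists of principal directions of the level set and of
the normal `Sum.inr ()`; `s` is the length of the gradient, `κ` are the principal curvatures, `a`
are the mixed second derivatives, and the Hessian is `hess` below. -/
structure LevelJet (m : ℕ) where
  s : ℝ
  κ : Fin m → ℝ
  a : Fin m → ℝ
  T : Fin m ⊕ Unit → Fin m ⊕ Unit → Fin m ⊕ Unit → ℝ
  Q : Fin m ⊕ Unit → Fin m ⊕ Unit → Fin m ⊕ Unit → Fin m ⊕ Unit → ℝ
  s_pos : 0 < s
  κ_pos : ∀ i, 0 < κ i
  T_swap_left : ∀ i j k, T i j k = T j i k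
  T_swap_right : ∀ i j k, T i j k = T i k j
  Q_symm : ∀ i j, Q i i j j = Q j j i i

noncomputable section LevelJetAlgebra

namespace LevelJet

variable {m : ℕ} (F : LevelJet m)

/-- The mean curvature of the level set. -/
def H : ℝ := ∑ i, F.κ i

/-- The second normal derivative, as determined by the equation. -/
def c : ℝ := F.s * (1 + F.s ^ 2) * F.H

/-- The Hessian. -/
def hess : Fin m ⊕ Unit → Fin m ⊕ Unit → ℝ
  | .inl i, .inl j => if i = j then -(F.s * F.κ i) else 0
  | .inl i, .inr _ => F.a i
  | .inr _, .inl j => F.a j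
  | .inr _, .inr _ => F.c

/-- The first derivatives of the minimal surface equation. -/
def FirstOrder : Prop := ∀ k,
  2 * F.s * F.hess (.inr ()) k * ∑ i, F.hess i i + (1 + F.s ^ 2) * ∑ i, F.T i i k
    - 2 * F.s * ∑ i, F.hess i k * F.hess i (.inr ()) - F.s ^ 2 * F.T (.inr ()) (.inr ()) k = 0

/-- The pure second derivatives of the minimal surface equation. -/
def SecondOrder : Prop := ∀ k,
  2 * (F.s * F.T (.inr ()) k k + ∑ i, F.hess i k ^ 2) * ∑ i, F.hess i i
    + 4 * F.s * F.hess (.inr ()) k * ∑ i, F.T i i k + (1 + F.s ^ 2) * ∑ i, F.Q i i k k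
    - 2 * F.s * ∑ i, F.T i k k * F.hess i (.inr ())
    - 2 * ∑ i, ∑ j, F.hess i k * F.hess j k * F.hess i j
    - 4 * F.s * ∑ i, F.hess i k * F.T i (.inr ()) k - F.s ^ 2 * F.Q (.inr ()) (.inr ()) k k = 0

/-- The linearized operator applied to `f`, with second derivatives `f l`. -/
def L (f : Fin m ⊕ Unit → ℝ) : ℝ := (1 + F.s ^ 2) * ∑ k, f (.inl k) + f (.inr ())

theorem sum_hess_diag : ∑ i, F.hess i i = F.s ^ 3 * F.H := by
  rw [Fintype.sum_sum_unit]
  simp only [hess, if_true, Finset.sum_neg_distrib, ← Finset.mul_sum]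
  rw [c, H]; ring

/-- The differentiated equation read as an equation for the component u_k: the coefficient of
T_{ννk} is (1 + s²) - s² = 1, so its third order part is L. -/
theorem L_gradient_tangential (h : F.FirstOrder) (k : Fin m) :
    F.L (fun l => F.T (.inl k) l l) = 2 * F.s ^ 2 * F.a k * (F.H - F.κ k) := by
  have h1 := h (.inl k)
  rw [sum_hess_diag, Fintype.sum_sum_unit, Fintype.sum_sum_unit] at h1
  have e : ∀ i, F.T (.inl k) i i = F.T i i (.inl k) := fun i => by
    rw [F.T_swap_left, F.T_swap_right]
  simp only [L, e]
  simp only [hess, ite_mul, zero_mul, Finset.sum_ite_eq', Finset.mem_univ, if_true] at h1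
  simp only [c] at h1
  linear_combination h1

theorem L_gradient_normal (h : F.FirstOrder) :
    F.L (fun l => F.T (.inr ()) l l)
      = 2 * F.s * ∑ k, F.a k ^ 2 + 2 * F.s ^ 2 * F.c * F.H := by
  have h1 := h (.inr ())
  rw [sum_hess_diag, Fintype.sum_sum_unit, Fintype.sum_sum_unit] at h1
  have e : ∀ i, F.T (.inr ()) i i = F.T i i (.inr ()) := fun i => by
    rw [F.T_swap_left, F.T_swap_right]
  simp only [L, e]
  simp only [hess, ← pow_two] at h1
  have hc : F.c = F.s * (1 + F.s ^ 2) * F.H := rfl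
  linear_combination h1 + 2 * F.s * F.c * hc

/-- The twice differentiated equation contains ∂_k² u_ll; `Q_symm` turns this into ∂_l² u_kk, so L
of the Hessian entries contains no fourth derivatives. -/
theorem L_hess_tangential (h : F.SecondOrder) (k : Fin m) :
    F.L (fun l => F.Q (.inl k) (.inl k) l l)
      = -2 * (F.s ^ 2 * F.κ k ^ 2 + F.a k ^ 2 + F.s * F.T (.inl k) (.inl k) (.inr ()))
          * (F.s ^ 3 * F.H)
        - 4 * F.s * F.a k * ∑ i, F.T (.inl k) (.inl i) (.inl i)
        + 2 * F.s * (∑ i, F.T (.inl k) (.inl k) (.inl i) * F.a i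
          + F.T (.inl k) (.inl k) (.inr ()) * F.c)
        - 4 * F.s ^ 2 * F.κ k * F.T (.inl k) (.inl k) (.inr ())
        + 2 * (-(F.s ^ 3 * F.κ k ^ 3) - 2 * F.s * F.κ k * F.a k ^ 2 + F.a k ^ 2 * F.c) := by
  have h1 := h (.inl k)
  rw [sum_hess_diag] at h1
  simp only [Fintype.sum_sum_unit] at h1
  have e : ∀ i j, F.T i j j = F.T j j i := fun i j => by rw [F.T_swap_left, F.T_swap_right]
  have e' : F.T (.inl k) (.inr ()) (.inl k) = F.T (.inl k) (.inl k) (.inr ()) := by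
    rw [F.T_swap_right]
  have e'' : ∀ i, F.T i i (.inl k) = F.T (.inl k) i i := fun i => by
    rw [F.T_swap_right, F.T_swap_left]
  simp only [L, F.Q_symm (.inl k)]
  simp only [hess, ite_mul, mul_ite, zero_mul, mul_zero, Finset.sum_ite_eq', Finset.sum_ite_eq,
    Finset.mem_univ, if_true, ite_pow, e', e _ (.inl k), e'',
    Finset.sum_add_distrib, ne_eq, OfNat.ofNat_ne_zero, not_false_eq_true, zero_pow] at h1
  linear_combination h1

end LevelJet

end LevelJetAlgebra

/-! ### The operator L on the logarithm of the bordered determinant. -/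

noncomputable section LevelJetIdentity

namespace LevelJet

variable {m : ℕ} (F : LevelJet m)

/-- The tangential block, differentiated in direction `l`, of the bordered Hessian in the frame that
diagonalizes it. -/
def S (l : Fin m ⊕ Unit) (i j : Fin m) : ℝ :=
  F.T (.inl i) (.inl j) l - F.a i / F.s * F.hess (.inl j) l - F.a j / F.s * F.hess (.inl i) l

/-- One expansion for two uses: shifts (0, 1) convert `S` into third derivatives of u, and both
shifts equal to 1 + (1 + s²)⁻¹ give the completed squares of `shiftedT`. -/
theorem sum_shift_sq (μ₁ μ₂ : ℝ) :
    ∑ k, ∑ i, ∑ j, (F.T (.inl i) (.inl j) (.inl k) + μ₁ * (if i = j then F.κ i * F.a k else 0)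
        + μ₂ * ((if j = k then F.κ j * F.a i else 0) + if i = k then F.κ i * F.a j else 0)) ^ 2
        / (F.κ i * F.κ j)
      = ∑ k, ∑ i, ∑ j, F.T (.inl i) (.inl j) (.inl k) ^ 2 / (F.κ i * F.κ j)
        + 2 * μ₁ * ∑ k, ∑ i, F.a k * F.T (.inl k) (.inl i) (.inl i) / F.κ i
        + 4 * μ₂ * ∑ k, ∑ i, F.a k * F.T (.inl k) (.inl i) (.inl i) / F.κ k
        + (μ₁ ^ 2 * m + 4 * μ₁ * μ₂ + 2 * μ₂ ^ 2) * ∑ k, F.a k ^ 2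
        + 2 * μ₂ ^ 2 * F.H * ∑ k, F.a k ^ 2 / F.κ k := by
  have e : ∀ i k, F.T (.inl i) (.inl i) (.inl k) = F.T (.inl k) (.inl i) (.inl i) := fun i k => by
    rw [F.T_swap_right, F.T_swap_left]
  have hpt : ∀ k i j, (F.T (.inl i) (.inl j) (.inl k)
        + μ₁ * (if i = j then F.κ i * F.a k else 0)
        + μ₂ * ((if j = k then F.κ j * F.a i else 0) + if i = k then F.κ i * F.a j else 0)) ^ 2
        / (F.κ i * F.κ j)
      = F.T (.inl i) (.inl j) (.inl k) ^ 2 / (F.κ i * F.κ j)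
        + (if i = j then 2 * μ₁ * (F.a k * F.T (.inl k) (.inl i) (.inl i) / F.κ i)
            + μ₁ ^ 2 * F.a k ^ 2 else 0)
        + (if j = k then 2 * μ₂ * (F.a i * F.T (.inl i) (.inl k) (.inl k) / F.κ i)
            + μ₂ ^ 2 * (F.κ k * (F.a i ^ 2 / F.κ i)) else 0)
        + (if i = k then 2 * μ₂ * (F.a j * F.T (.inl j) (.inl k) (.inl k) / F.κ j)
            + μ₂ ^ 2 * (F.κ k * (F.a j ^ 2 / F.κ j)) else 0)
        + (if i = j then if j = k then (4 * μ₁ * μ₂ + 2 * μ₂ ^ 2) * F.a k ^ 2 else 0 else 0) := by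
    intro k i j
    have hi := (F.κ_pos i).ne'
    have hj := (F.κ_pos j).ne'
    have hk := (F.κ_pos k).ne'
    by_cases h1 : i = j
    · subst h1
      by_cases h2 : i = k
      · subst h2; simp only [if_true]; field_simp; ring
      · simp only [if_true, h2, if_false, e]; field_simp; ring
    · by_cases h2 : j = k
      · subst h2
        simp only [if_true, h1, if_false]; field_simp; ring
      · by_cases h3 : i = k
        · subst h3
          simp only [if_true, h1, h2, if_false, F.T_swap_left _ (.inl j) _]
          field_simp; ring
        · simp only [h1, h2, h3, if_false]; ring
  simp only [hpt, Finset.sum_add_distrib, Finset.sum_ite_eq, Finset.sum_ite_eq', Finset.mem_univ,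
    if_true, Finset.sum_ite_irrel, Finset.sum_const_zero, ← Finset.mul_sum, ← Finset.sum_mul,
    Finset.sum_const, Finset.card_univ, Fintype.card_fin, nsmul_eq_mul]
  have e3 : ∑ k, ∑ i, F.a i * F.T (.inl i) (.inl k) (.inl k) / F.κ i
      = ∑ k, ∑ i, F.a k * F.T (.inl k) (.inl i) (.inl i) / F.κ k := Finset.sum_comm
  rw [e3, H]
  ring

/-- The mixed entries, differentiated in direction `l`, of the bordered Hessian. -/
def X (l : Fin m ⊕ Unit) (i : Fin m) : ℝ :=
  F.T (.inl i) (.inr ()) l - F.a i / F.s * F.hess (.inr ()) l - F.c / (2 * F.s) * F.hess (.inl i) l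

/-- First derivative of `log |det|` of the bordered Hessian. -/
def logDet₁ (l : Fin m ⊕ Unit) : ℝ :=
  ∑ i, -(F.s * F.κ i)⁻¹ * F.S l i i + 2 * F.s⁻¹ * F.hess (.inr ()) l

/-- Second derivative of `log |det|` of the bordered Hessian. -/
def logDet₂ (l : Fin m ⊕ Unit) : ℝ :=
  ∑ i, -(F.s * F.κ i)⁻¹ * (F.Q (.inl i) (.inl i) l l - F.a i / F.s * F.T (.inl i) l l
      - F.a i / F.s * F.T (.inl i) l l) + 2 * F.s⁻¹ * F.T (.inr ()) l l
    - (∑ i, ∑ j, -(F.s * F.κ i)⁻¹ * -(F.s * F.κ j)⁻¹ * F.S l i j ^ 2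
      + 4 * F.s⁻¹ * ∑ i, -(F.s * F.κ i)⁻¹ * (F.X l i * F.hess (.inl i) l)
      + 2 * (F.s⁻¹ * F.hess (.inr ()) l) ^ 2)

/-- First derivative of the squared length of the gradient. -/
def gradSq₁ (l : Fin m ⊕ Unit) : ℝ := 2 * F.s * F.hess (.inr ()) l

/-- Second derivative of the squared length of the gradient. -/
def gradSq₂ (l : Fin m ⊕ Unit) : ℝ :=
  2 * (F.s * F.T (.inr ()) l l + ∑ i, F.hess i l ^ 2)

/-- First derivative of the logarithm of the weighted curvature. -/
def logCurv₁ (θ : ℝ) (l : Fin m ⊕ Unit) : ℝ :=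
  F.logDet₁ l + (θ - (m + 2) / 2) * (F.gradSq₁ l / F.s ^ 2) - θ * (F.gradSq₁ l / (1 + F.s ^ 2))

/-- Second derivative of the logarithm of the weighted curvature. -/
def logCurv₂ (θ : ℝ) (l : Fin m ⊕ Unit) : ℝ :=
  F.logDet₂ l + (θ - (m + 2) / 2) * (F.gradSq₂ l / F.s ^ 2 - (F.gradSq₁ l / F.s ^ 2) ^ 2)
    - θ * (F.gradSq₂ l / (1 + F.s ^ 2) - (F.gradSq₁ l / (1 + F.s ^ 2)) ^ 2)

theorem L_add (f g : Fin m ⊕ Unit → ℝ) : F.L (fun l => f l + g l) = F.L f + F.L g := by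
  simp only [L, Finset.sum_add_distrib]; ring

theorem L_sub (f g : Fin m ⊕ Unit → ℝ) : F.L (fun l => f l - g l) = F.L f - F.L g := by
  simp only [L, Finset.sum_sub_distrib]; ring

theorem L_const_mul (c : ℝ) (f : Fin m ⊕ Unit → ℝ) : F.L (fun l => c * f l) = c * F.L f := by
  simp only [L, ← Finset.mul_sum]; ring

theorem L_sum {ι : Type*} (s : Finset ι) (f : ι → Fin m ⊕ Unit → ℝ) :
    F.L (fun l => ∑ i ∈ s, f i l) = ∑ i ∈ s, F.L (f i) := by
  simp only [L, Finset.sum_add_distrib, ← Finset.mul_sum]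
  rw [Finset.sum_comm]

theorem L_gradSq₁_sq :
    F.L (fun l => F.gradSq₁ l ^ 2)
      = 4 * F.s ^ 2 * ((1 + F.s ^ 2) * ∑ k, F.a k ^ 2 + F.c ^ 2) := by
  simp only [L, gradSq₁, hess, mul_pow, ← Finset.mul_sum]
  ring

theorem L_gradSq₂ (h : F.FirstOrder) :
    F.L F.gradSq₂ = 2 * F.s * (2 * F.s * ∑ k, F.a k ^ 2 + 2 * F.s ^ 2 * F.c * F.H)
      + 2 * ((1 + F.s ^ 2) * (F.s ^ 2 * ∑ k, F.κ k ^ 2 + ∑ k, F.a k ^ 2)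
        + ∑ k, F.a k ^ 2 + F.c ^ 2) := by
  have e : F.gradSq₂ = fun l => 2 * F.s * F.T (.inr ()) l l + 2 * ∑ i, F.hess i l ^ 2 := by
    funext l; rw [gradSq₂]; ring
  rw [e, L_add, L_const_mul _ _ (fun l => F.T (.inr ()) l l), L_gradient_normal F h, L_const_mul]
  congr 1
  simp only [L, Fintype.sum_sum_unit, hess, ite_pow, ne_eq, OfNat.ofNat_ne_zero,
    not_false_eq_true, zero_pow, Finset.sum_ite_eq', Finset.mem_univ, if_true, neg_sq, mul_pow,
    Finset.sum_add_distrib, ← Finset.mul_sum]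
  ring

/-- The part of L(log |det|) linear in the second derivatives of the matrix, that is tr(N M₂); the
differentiated equations reduce it to third order sums. -/
theorem L_bordered_second (h : F.FirstOrder) (h' : F.SecondOrder) :
    F.L (fun l => ∑ i, -(F.s * F.κ i)⁻¹ * (F.Q (.inl i) (.inl i) l l
        - F.a i / F.s * F.T (.inl i) l l - F.a i / F.s * F.T (.inl i) l l)
        + 2 * F.s⁻¹ * F.T (.inr ()) l l)
      = -F.s⁻¹ * (-2 * F.s ^ 3 * F.H * (F.s ^ 2 * F.H + ∑ k, F.a k ^ 2 / F.κ k
            + F.s * ∑ k, F.T (.inl k) (.inl k) (.inr ()) / F.κ k)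
          - 4 * F.s * ∑ k, ∑ i, F.a k * F.T (.inl k) (.inl i) (.inl i) / F.κ k
          + 2 * F.s * ∑ k, ∑ i, F.a k * F.T (.inl k) (.inl i) (.inl i) / F.κ i
          + 2 * F.s * F.c * ∑ k, F.T (.inl k) (.inl k) (.inr ()) / F.κ k
          - 4 * F.s ^ 2 * ∑ k, F.T (.inl k) (.inl k) (.inr ())
          - 2 * F.s ^ 3 * ∑ k, F.κ k ^ 2 - 4 * F.s * ∑ k, F.a k ^ 2
          + 2 * F.c * ∑ k, F.a k ^ 2 / F.κ k)
        + 4 * (F.H * ∑ k, F.a k ^ 2 / F.κ k - ∑ k, F.a k ^ 2)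
        + 2 * F.s⁻¹ * (2 * F.s * ∑ k, F.a k ^ 2 + 2 * F.s ^ 2 * F.c * F.H) := by
  have hs := F.s_pos.ne'
  rw [L_add, L_sum, L_const_mul _ _ (fun l => F.T (.inr ()) l l), L_gradient_normal F h]
  congr 1
  have e1 : ∀ i, F.L (fun l => -(F.s * F.κ i)⁻¹ * (F.Q (.inl i) (.inl i) l l
        - F.a i / F.s * F.T (.inl i) l l - F.a i / F.s * F.T (.inl i) l l))
      = -F.s⁻¹ * (-2 * F.s ^ 3 * F.H * (F.s ^ 2 * F.κ i + F.a i ^ 2 / F.κ i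
            + F.s * (F.T (.inl i) (.inl i) (.inr ()) / F.κ i))
          - 4 * F.s * ∑ j, F.a i * F.T (.inl i) (.inl j) (.inl j) / F.κ i
          + 2 * F.s * ∑ j, F.a j * F.T (.inl j) (.inl i) (.inl i) / F.κ i
          + 2 * F.s * F.c * (F.T (.inl i) (.inl i) (.inr ()) / F.κ i)
          - 4 * F.s ^ 2 * F.T (.inl i) (.inl i) (.inr ())
          - 2 * F.s ^ 3 * F.κ i ^ 2 - 4 * F.s * F.a i ^ 2
          + 2 * F.c * (F.a i ^ 2 / F.κ i))
        + 4 * (F.H * (F.a i ^ 2 / F.κ i) - F.a i ^ 2) := by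
    intro i
    have hi := (F.κ_pos i).ne'
    rw [L_const_mul, L_sub, L_sub, L_const_mul _ _ (fun l => F.T (.inl i) l l),
      L_gradient_tangential F h, L_hess_tangential F h']
    have e2 : ∑ j, F.a i * F.T (.inl i) (.inl j) (.inl j) / F.κ i
        = F.a i / F.κ i * ∑ j, F.T (.inl i) (.inl j) (.inl j) := by
      rw [Finset.mul_sum]; exact Finset.sum_congr rfl fun j _ => by ring
    have e3 : ∑ j, F.a j * F.T (.inl j) (.inl i) (.inl i) / F.κ i
        = (∑ j, F.T (.inl i) (.inl i) (.inl j) * F.a j) / F.κ i := by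
      rw [Finset.sum_div]
      refine Finset.sum_congr rfl fun j _ => ?_
      rw [F.T_swap_left (.inl j), F.T_swap_right (.inl i) (.inl j)]; ring
    rw [e2, e3]
    field_simp
    ring
  have e4 : ∑ i, ∑ j, F.a j * F.T (.inl j) (.inl i) (.inl i) / F.κ i
      = ∑ k, ∑ i, F.a k * F.T (.inl k) (.inl i) (.inl i) / F.κ i := Finset.sum_comm
  rw [Finset.sum_congr rfl fun i _ => e1 i]
  simp only [Finset.sum_add_distrib, Finset.sum_sub_distrib, ← Finset.mul_sum, e4, H]

theorem sum_S_tangential_sq :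
    ∑ k, ∑ i, ∑ j, F.S (.inl k) i j ^ 2 / (F.κ i * F.κ j)
      = ∑ k, ∑ i, ∑ j, F.T (.inl i) (.inl j) (.inl k) ^ 2 / (F.κ i * F.κ j)
        + 4 * ∑ k, ∑ i, F.a k * F.T (.inl k) (.inl i) (.inl i) / F.κ k
        + 2 * ∑ k, F.a k ^ 2 + 2 * F.H * ∑ k, F.a k ^ 2 / F.κ k := by
  have h := F.sum_shift_sq 0 1
  have hs := F.s_pos.ne'
  have e : ∀ k i j, F.S (.inl k) i j = F.T (.inl i) (.inl j) (.inl k)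
      + 0 * (if i = j then F.κ i * F.a k else 0)
        + 1 * ((if j = k then F.κ j * F.a i else 0) + if i = k then F.κ i * F.a j else 0) := by
    intro k i j
    simp only [S, hess]
    split_ifs <;> field_simp <;> ring
  simp only [e, h]
  ring

/-- The quadratic part tr(N M₁ N M₁). Only T_{iνν} is not of the form needed later; `e7` eliminates
it by the first derivative of the equation. -/
theorem L_bordered_first (h : F.FirstOrder) :
    F.L (fun l => ∑ i, ∑ j, -(F.s * F.κ i)⁻¹ * -(F.s * F.κ j)⁻¹ * F.S l i j ^ 2
      + 4 * F.s⁻¹ * ∑ i, -(F.s * F.κ i)⁻¹ * (F.X l i * F.hess (.inl i) l)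
      + 2 * (F.s⁻¹ * F.hess (.inr ()) l) ^ 2)
      = (1 + F.s ^ 2) * (F.s⁻¹ ^ 2 * ∑ k, ∑ i, ∑ j, F.S (.inl k) i j ^ 2 / (F.κ i * F.κ j)
          + 4 * F.s⁻¹ * (∑ k, F.T (.inl k) (.inl k) (.inr ()) - F.s⁻¹ * ∑ k, F.a k ^ 2
            + F.c * F.H / 2)
          + 2 * F.s⁻¹ ^ 2 * ∑ k, F.a k ^ 2)
        + F.s⁻¹ ^ 2 * ∑ i, ∑ j, F.S (.inr ()) i j ^ 2 / (F.κ i * F.κ j)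
        - 4 * F.s⁻¹ ^ 2 * (2 * F.s ^ 2 * (F.H * ∑ k, F.a k ^ 2 / F.κ k - ∑ k, F.a k ^ 2)
          - (1 + F.s ^ 2) * ∑ k, ∑ i, F.a k * F.T (.inl k) (.inl i) (.inl i) / F.κ k
          - 3 * F.c * F.s⁻¹ / 2 * ∑ k, F.a k ^ 2 / F.κ k)
        + 2 * F.s⁻¹ ^ 2 * F.c ^ 2 := by
  have hs := F.s_pos.ne'
  have e1 : ∀ l, ∑ i, ∑ j, -(F.s * F.κ i)⁻¹ * -(F.s * F.κ j)⁻¹ * F.S l i j ^ 2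
      = F.s⁻¹ ^ 2 * ∑ i, ∑ j, F.S l i j ^ 2 / (F.κ i * F.κ j) := by
    intro l
    simp only [Finset.mul_sum]
    refine Finset.sum_congr rfl fun i _ => Finset.sum_congr rfl fun j _ => ?_
    have hi := (F.κ_pos i).ne'
    have hj := (F.κ_pos j).ne'
    field_simp
  have e2 : ∀ k, ∑ i, -(F.s * F.κ i)⁻¹ * (F.X (.inl k) i * F.hess (.inl i) (.inl k))
      = F.T (.inl k) (.inl k) (.inr ()) - F.s⁻¹ * F.a k ^ 2 + F.c / 2 * F.κ k := by
    intro k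
    have hk := (F.κ_pos k).ne'
    simp only [hess, mul_ite, mul_zero, Finset.sum_ite_eq', Finset.mem_univ, if_true, X,
      F.T_swap_right (.inl k) (.inr ()) (.inl k)]
    field_simp
    ring
  have e3 : ∑ i, -(F.s * F.κ i)⁻¹ * (F.X (.inr ()) i * F.hess (.inl i) (.inr ()))
      = -F.s⁻¹ * (2 * F.s ^ 2 * (F.H * ∑ k, F.a k ^ 2 / F.κ k - ∑ k, F.a k ^ 2)
          - (1 + F.s ^ 2) * ∑ k, ∑ i, F.a k * F.T (.inl k) (.inl i) (.inl i) / F.κ k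
          - 3 * F.c * F.s⁻¹ / 2 * ∑ k, F.a k ^ 2 / F.κ k) := by
    have e4 : ∀ i, -(F.s * F.κ i)⁻¹ * (F.X (.inr ()) i * F.hess (.inl i) (.inr ()))
        = -F.s⁻¹ * (2 * F.s ^ 2 * (F.H * (F.a i ^ 2 / F.κ i) - F.a i ^ 2)
          - (1 + F.s ^ 2) * ∑ j, F.a i * F.T (.inl i) (.inl j) (.inl j) / F.κ i
          - 3 * F.c * F.s⁻¹ / 2 * (F.a i ^ 2 / F.κ i)) := by
      intro i
      have hi := (F.κ_pos i).ne'
      have e5 : ∑ j, F.a i * F.T (.inl i) (.inl j) (.inl j) / F.κ i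
          = F.a i / F.κ i * ∑ j, F.T (.inl i) (.inl j) (.inl j) := by
        rw [Finset.mul_sum]; exact Finset.sum_congr rfl fun j _ => by ring
      have e6 := F.L_gradient_tangential h i
      simp only [L] at e6
      have e7 : F.T (.inl i) (.inr ()) (.inr ()) = 2 * F.s ^ 2 * F.a i * (F.H - F.κ i)
        - (1 + F.s ^ 2) * ∑ j, F.T (.inl i) (.inl j) (.inl j) := by linarith
      rw [e5, X, e7]
      simp only [hess]
      field_simp
      ring
    rw [Finset.sum_congr rfl fun i _ => e4 i]
    simp only [Finset.sum_sub_distrib, ← Finset.mul_sum]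
  simp only [L, e1, e2, e3]
  simp only [Finset.sum_add_distrib, Finset.sum_sub_distrib, ← Finset.mul_sum, hess, mul_pow]
  rw [show ∑ i, F.κ i = F.H from rfl]
  ring

end LevelJet

end LevelJetIdentity

/-! ### Completion of squares and the differential inequality. -/

noncomputable section LevelJetInequality

namespace LevelJet

variable {m : ℕ} (F : LevelJet m)

/-- The third derivatives, shifted so as to complete the tangential squares. -/
def shiftedT (k i j : Fin m) : ℝ :=
  F.T (.inl i) (.inl j) (.inl k)
    + (1 + (1 + F.s ^ 2)⁻¹) * (if i = j then F.κ i * F.a k else 0)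
    + (1 + (1 + F.s ^ 2)⁻¹)
      * ((if j = k then F.κ j * F.a i else 0) + if i = k then F.κ i * F.a j else 0)

/-- The normal derivative of the tangential block, shifted so as to complete the squares. -/
def shiftedS (i j : Fin m) : ℝ :=
  F.S (.inr ()) i j
    + if i = j then F.s * F.κ i * ((1 + F.s ^ 2) * F.H + 2 * F.κ i) else 0

theorem S_normal_diag (i : Fin m) :
    F.S (.inr ()) i i = F.T (.inl i) (.inl i) (.inr ()) - 2 * F.s⁻¹ * F.a i ^ 2 := by
  simp only [S, hess]; ring

theorem sum_S_normal_div :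
    ∑ i, F.S (.inr ()) i i / F.κ i
      = ∑ k, F.T (.inl k) (.inl k) (.inr ()) / F.κ k - 2 * F.s⁻¹ * ∑ k, F.a k ^ 2 / F.κ k := by
  rw [Finset.mul_sum, ← Finset.sum_sub_distrib]
  exact Finset.sum_congr rfl fun i _ => by rw [S_normal_diag]; ring

theorem sum_shiftedS_sq :
    ∑ i, ∑ j, F.shiftedS i j ^ 2 / (F.κ i * F.κ j)
      = ∑ i, ∑ j, F.S (.inr ()) i j ^ 2 / (F.κ i * F.κ j)
        + 2 * F.s * ((1 + F.s ^ 2) * F.H * (∑ k, F.T (.inl k) (.inl k) (.inr ()) / F.κ k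
            - 2 * F.s⁻¹ * ∑ k, F.a k ^ 2 / F.κ k)
          + 2 * (∑ k, F.T (.inl k) (.inl k) (.inr ()) - 2 * F.s⁻¹ * ∑ k, F.a k ^ 2))
        + F.s ^ 2 * (m * ((1 + F.s ^ 2) * F.H) ^ 2 + 4 * (1 + F.s ^ 2) * F.H ^ 2
          + 4 * ∑ k, F.κ k ^ 2) := by
  have e : ∀ i j, F.shiftedS i j ^ 2 / (F.κ i * F.κ j)
      = F.S (.inr ()) i j ^ 2 / (F.κ i * F.κ j)
        + if i = j then 2 * F.s * ((1 + F.s ^ 2) * F.H * (F.S (.inr ()) i i / F.κ i)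
            + 2 * (F.T (.inl i) (.inl i) (.inr ()) - 2 * F.s⁻¹ * F.a i ^ 2))
          + F.s ^ 2 * (((1 + F.s ^ 2) * F.H) ^ 2 + 4 * (1 + F.s ^ 2) * F.H * F.κ i
            + 4 * F.κ i ^ 2) else 0 := by
    intro i j
    have hi := (F.κ_pos i).ne'
    by_cases h : i = j
    · subst h
      rw [← S_normal_diag]
      simp only [shiftedS, if_true]
      field_simp
      ring
    · simp [shiftedS, h]
  simp only [e, Finset.sum_add_distrib, Finset.sum_ite_eq, Finset.mem_univ, if_true,
    ← Finset.mul_sum, Finset.sum_sub_distrib, sum_S_normal_div, Finset.sum_const,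
    Finset.card_univ, Fintype.card_fin, nsmul_eq_mul]
  rw [show ∑ i, F.κ i = F.H from rfl]
  ring

theorem sum_S_tangential_diag (k : Fin m) :
    ∑ i, F.S (.inl k) i i / F.κ i
      = ∑ i, F.T (.inl k) (.inl i) (.inl i) / F.κ i + 2 * F.a k := by
  have hs := F.s_pos.ne'
  have e : ∀ i, F.S (.inl k) i i / F.κ i = F.T (.inl k) (.inl i) (.inl i) / F.κ i
      + if i = k then 2 * F.a i else 0 := by
    intro i
    have hi := (F.κ_pos i).ne'
    rw [S, F.T_swap_right (.inl i), F.T_swap_left (.inl i)]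
    simp only [hess]
    split_ifs
    · field_simp; ring
    · ring
  simp only [e, Finset.sum_add_distrib, Finset.sum_ite_eq', Finset.mem_univ, if_true]

theorem logDet₁_eq (l : Fin m ⊕ Unit) :
    F.logDet₁ l = -F.s⁻¹ * ∑ i, F.S l i i / F.κ i + 2 * F.s⁻¹ * F.hess (.inr ()) l := by
  rw [logDet₁, Finset.mul_sum]
  congr 1
  exact Finset.sum_congr rfl fun i _ => by rw [mul_inv]; ring

theorem logCurv₁_tangential (θ : ℝ) (k : Fin m) :
    F.logCurv₁ θ (.inl k) = -F.s⁻¹ * (∑ i, F.T (.inl k) (.inl i) (.inl i) / F.κ i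
      + (m + 2) * F.a k - 2 * θ * (1 + F.s ^ 2)⁻¹ * F.a k) := by
  have hs := F.s_pos.ne'
  have hw : 1 + F.s ^ 2 ≠ 0 := by positivity
  rw [logCurv₁, logDet₁_eq, sum_S_tangential_diag]
  simp only [gradSq₁, hess]
  field_simp
  ring

theorem logCurv₁_normal (θ : ℝ) :
    F.logCurv₁ θ (.inr ()) = -F.s⁻¹ * (∑ k, F.T (.inl k) (.inl k) (.inr ()) / F.κ k
        - 2 * F.s⁻¹ * ∑ k, F.a k ^ 2 / F.κ k) - m * (1 + F.s ^ 2) * F.H + 2 * θ * F.H := by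
  have hs := F.s_pos.ne'
  have hw : 1 + F.s ^ 2 ≠ 0 := by positivity
  rw [logCurv₁, logDet₁_eq, sum_S_normal_div]
  simp only [gradSq₁, hess, c]
  field_simp
  ring

theorem sum_mul_logCurv₁ (θ : ℝ) :
    ∑ k, F.a k * F.logCurv₁ θ (.inl k)
      = -F.s⁻¹ * (∑ k, ∑ i, F.a k * F.T (.inl k) (.inl i) (.inl i) / F.κ i
        + (m + 2 - 2 * θ * (1 + F.s ^ 2)⁻¹) * ∑ k, F.a k ^ 2) := by
  have e : ∀ k, F.a k * F.logCurv₁ θ (.inl k)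
      = -F.s⁻¹ * (∑ i, F.a k * F.T (.inl k) (.inl i) (.inl i) / F.κ i
        + (m + 2 - 2 * θ * (1 + F.s ^ 2)⁻¹) * F.a k ^ 2) := by
    intro k
    rw [logCurv₁_tangential, Finset.sum_congr rfl fun i _ => (show
      F.a k * F.T (.inl k) (.inl i) (.inl i) / F.κ i
        = F.a k * (F.T (.inl k) (.inl i) (.inl i) / F.κ i) by ring), ← Finset.mul_sum]
    ring
  simp only [e, ← Finset.mul_sum, Finset.sum_add_distrib]

/-- The linearized operator applied to the logarithm of the weighted curvature is, up to first
order terms, minus a sum of squares. -/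
theorem L_logCurv₂ (θ : ℝ) (h : F.FirstOrder) (h' : F.SecondOrder) :
    F.L (F.logCurv₂ θ) = -(
      (1 + F.s ^ 2) * F.s⁻¹ ^ 2 * ∑ k, ∑ i, ∑ j, F.shiftedT k i j ^ 2 / (F.κ i * F.κ j)
      + F.s⁻¹ ^ 2 * ∑ i, ∑ j, F.shiftedS i j ^ 2 / (F.κ i * F.κ j)
      + (1 + F.s ^ 2)⁻¹ * ((m - 2 + 2 * θ - 8 * (1 + θ) * F.s⁻¹ ^ 2) * ∑ k, F.a k ^ 2
          + 2 * F.H * ∑ k, F.a k ^ 2 / F.κ k)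
      + ((m * (1 + F.s ^ 2) - 2 - 2 * θ) * ∑ k, F.κ k ^ 2
          + (2 * θ * (1 + F.s ^ 2) - 4 * θ - 2) * F.H ^ 2)
      + 2 * F.H * F.logCurv₁ θ (.inr ())
      + 4 * F.s⁻¹ * ∑ k, F.a k * F.logCurv₁ θ (.inl k)) := by
  have hs := F.s_pos.ne'
  have hw : 1 + F.s ^ 2 ≠ 0 := by positivity
  have e : F.logCurv₂ θ = fun l => F.logDet₂ l
      + (((θ - (m + 2) / 2) * (F.s ^ 2)⁻¹ - θ * (1 + F.s ^ 2)⁻¹) * F.gradSq₂ l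
        + (θ * (1 + F.s ^ 2)⁻¹ ^ 2 - (θ - (m + 2) / 2) * (F.s ^ 2)⁻¹ ^ 2) * F.gradSq₁ l ^ 2) := by
    funext l; rw [logCurv₂]; ring
  rw [e, L_add, L_add, L_const_mul, L_const_mul, L_gradSq₂ F h, L_gradSq₁_sq]
  unfold logDet₂
  rw [L_sub, L_bordered_second F h h', L_bordered_first F h, sum_S_tangential_sq, sum_shiftedS_sq, logCurv₁_normal, sum_mul_logCurv₁]
  simp only [shiftedT]
  rw [sum_shift_sq]
  simp only [c]
  -- Both sides are now rational expressions in s, H, m, θ and nine sums. The gradient terms take up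
  -- `P` and `nκ`, the shifted squares the remaining sums with third derivatives.
  generalize ∑ k, ∑ i, ∑ j, F.T (.inl i) (.inl j) (.inl k) ^ 2 / (F.κ i * F.κ j) = TT
  generalize ∑ i, ∑ j, F.S (.inr ()) i j ^ 2 / (F.κ i * F.κ j) = ZZ
  generalize ∑ k, ∑ i, F.a k * F.T (.inl k) (.inl i) (.inl i) / F.κ i = P
  generalize ∑ k, ∑ i, F.a k * F.T (.inl k) (.inl i) (.inl i) / F.κ k = R
  generalize ∑ k, F.T (.inl k) (.inl k) (.inr ()) / F.κ k = nκ
  generalize ∑ k, F.T (.inl k) (.inl k) (.inr ()) = n₁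
  generalize ∑ k, F.a k ^ 2 / F.κ k = aκ
  generalize ∑ k, F.a k ^ 2 = aa
  generalize ∑ k, F.κ k ^ 2 = kk
  generalize F.H = H
  generalize F.s = s at hs hw
  field_simp
  ring

/-- The trace of the third derivatives against κ⁻¹ is what the gradient of the logarithmic curvature
measures. So the trace of the shifted array is of lower order modulo that gradient, and its square
can be used against the remaining terms. -/
theorem sum_shiftedT_diag (θ : ℝ) (k : Fin m) :
    ∑ i, F.shiftedT k i i / F.κ i
      = (2 * θ + m + 2) * (1 + F.s ^ 2)⁻¹ * F.a k - F.s * F.logCurv₁ θ (.inl k) := by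
  have hs := F.s_pos.ne'
  have e : ∀ i, F.shiftedT k i i / F.κ i = F.T (.inl k) (.inl i) (.inl i) / F.κ i
      + ((1 + (1 + F.s ^ 2)⁻¹) * F.a k
        + if i = k then 2 * (1 + (1 + F.s ^ 2)⁻¹) * F.a i else 0) := by
    intro i
    have hi := (F.κ_pos i).ne'
    rw [shiftedT, F.T_swap_right (.inl i), F.T_swap_left (.inl i)]
    simp only [if_true]
    split_ifs <;> field_simp <;> ring
  simp only [e, Finset.sum_add_distrib, Finset.sum_ite_eq', Finset.mem_univ, if_true,
    logCurv₁_tangential, Finset.sum_const, Finset.card_univ, Fintype.card_fin, nsmul_eq_mul]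
  field_simp
  ring

theorem sum_shiftedS_diag (θ : ℝ) :
    ∑ i, F.shiftedS i i / F.κ i
      = F.s * ((2 * θ + 2) * F.H - F.logCurv₁ θ (.inr ())) := by
  have hs := F.s_pos.ne'
  have e : ∀ i, F.shiftedS i i / F.κ i = F.S (.inr ()) i i / F.κ i
      + (F.s * (1 + F.s ^ 2) * F.H + 2 * F.s * F.κ i) := by
    intro i
    have hi := (F.κ_pos i).ne'
    simp only [shiftedS, if_true]
    field_simp
  simp only [e, Finset.sum_add_distrib, sum_S_normal_div, logCurv₁_normal, Finset.sum_const,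
    Finset.card_univ, Fintype.card_fin, nsmul_eq_mul, ← Finset.mul_sum]
  rw [show ∑ i, F.κ i = F.H from rfl]
  field_simp
  ring

/-- Cauchy–Schwarz over the m diagonal entries, after dropping the off-diagonal squares. -/
theorem sq_sum_diag_div_le (f : Fin m → Fin m → ℝ) :
    (∑ i, f i i / F.κ i) ^ 2 ≤ m * ∑ i, ∑ j, f i j ^ 2 / (F.κ i * F.κ j) := by
  have h1 := sq_sum_le_card_mul_sum_sq (s := Finset.univ) (f := fun i => f i i / F.κ i)
  rw [Finset.card_univ, Fintype.card_fin] at h1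
  refine h1.trans (mul_le_mul_of_nonneg_left (Finset.sum_le_sum fun i _ => ?_) (Nat.cast_nonneg m))
  have h2 : ∀ j ∈ Finset.univ, 0 ≤ f i j ^ 2 / (F.κ i * F.κ j) := fun j _ =>
    div_nonneg (sq_nonneg _) (mul_pos (F.κ_pos i) (F.κ_pos j)).le
  refine le_trans (le_of_eq ?_) (Finset.single_le_sum h2 (Finset.mem_univ i))
  rw [div_pow, pow_two (F.κ i)]

theorem κ_le_H (i : Fin m) : F.κ i ≤ F.H :=
  Finset.single_le_sum (f := F.κ) (fun j _ => (F.κ_pos j).le) (Finset.mem_univ i)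

theorem H_nonneg : 0 ≤ F.H := Finset.sum_nonneg fun j _ => (F.κ_pos j).le

theorem sum_κ_sq_le : ∑ k, F.κ k ^ 2 ≤ F.H ^ 2 := by
  rw [pow_two F.H]
  nth_rewrite 1 [H]
  rw [Finset.sum_mul]
  refine Finset.sum_le_sum fun i _ => ?_
  rw [pow_two]
  exact mul_le_mul_of_nonneg_left (F.κ_le_H i) (F.κ_pos i).le

theorem H_sq_le : F.H ^ 2 ≤ m * ∑ k, F.κ k ^ 2 := by
  have h1 := sq_sum_le_card_mul_sum_sq (s := Finset.univ) (f := F.κ)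
  rwa [Finset.card_univ, Fintype.card_fin] at h1

theorem sum_a_sq_le : ∑ k, F.a k ^ 2 ≤ F.H * ∑ k, F.a k ^ 2 / F.κ k := by
  rw [Finset.mul_sum]
  refine Finset.sum_le_sum fun i _ => ?_
  rw [mul_div_assoc', le_div_iff₀ (F.κ_pos i), mul_comm]
  exact mul_le_mul_of_nonneg_right (F.κ_le_H i) (sq_nonneg _)

/-- The summand (2θ + 2)²/m is the gain from the trace of `shiftedS`. For θ = -1/2 the form is a
nonnegative multiple of m ∑ κ² - H². In the other range m ≥ 2 ensures θ ≥ 0, and ∑ κ² ≤ H² suffices.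
-/
theorem curvature_terms_nonneg {θ : ℝ} (hm : 1 ≤ m)
    (hθ : θ = -1 / 2 ∨ (2 ≤ m ∧ ((m : ℝ) - 2) / 2 ≤ θ)) :
    0 ≤ (m * (1 + F.s ^ 2) - 2 - 2 * θ) * ∑ k, F.κ k ^ 2
      + (2 * θ * (1 + F.s ^ 2) - 4 * θ - 2 + (2 * θ + 2) ^ 2 / m) * F.H ^ 2 := by
  have hm' : (1 : ℝ) ≤ m := by exact_mod_cast hm
  have h1 := F.sum_κ_sq_le
  have h2 := F.H_sq_le
  set kk := ∑ k, F.κ k ^ 2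
  rcases hθ with rfl | ⟨hm2, hθ⟩
  · have e : ((m : ℝ) * (1 + F.s ^ 2) - 2 - 2 * (-1 / 2)) * kk
      + (2 * (-1 / 2) * (1 + F.s ^ 2) - 4 * (-1 / 2) - 2 + (2 * (-1 / 2) + 2) ^ 2 / m) * F.H ^ 2
      = (F.s ^ 2 + (m - 1) / m) * (m * kk - F.H ^ 2) := by
      field_simp; ring
    rw [e]
    refine mul_nonneg (add_nonneg (sq_nonneg _) (div_nonneg ?_ ?_)) ?_ <;> linarith
  · have hm2' : (2 : ℝ) ≤ m := by exact_mod_cast hm2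
    have hkk : 0 ≤ kk := Finset.sum_nonneg fun _ _ => sq_nonneg _
    have e : ((m : ℝ) * (1 + F.s ^ 2) - 2 - 2 * θ) * kk
      + (2 * θ * (1 + F.s ^ 2) - 4 * θ - 2 + (2 * θ + 2) ^ 2 / m) * F.H ^ 2
      = F.s ^ 2 * (m * kk + 2 * θ * F.H ^ 2) + (2 * θ + 2 - m) * (F.H ^ 2 - kk)
        + (2 * θ + 2 - m) ^ 2 / m * F.H ^ 2 := by
      field_simp; ring
    rw [e]
    have h3 : 0 ≤ 2 * θ + 2 - m := by linarith
    have h4 : 0 ≤ θ := by linarith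
    have h5 : 0 ≤ F.H ^ 2 - kk := by linarith
    positivity

/-- The gain (2θ + m + 2)²/m from the trace of `shiftedT` turns -8(1 + θ) into the perfect square
(2θ - m + 2)²/m; the rest uses κ_i ≤ H and m + 2θ ≥ 0. -/
theorem mixed_terms_nonneg {θ : ℝ} (hm : 1 ≤ m)
    (hθ : θ = -1 / 2 ∨ (2 ≤ m ∧ ((m : ℝ) - 2) / 2 ≤ θ)) :
    0 ≤ (m - 2 + 2 * θ - 8 * (1 + θ) * F.s⁻¹ ^ 2
        + (2 * θ + m + 2) ^ 2 / m * F.s⁻¹ ^ 2) * ∑ k, F.a k ^ 2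
      + 2 * F.H * ∑ k, F.a k ^ 2 / F.κ k := by
  have hm' : (1 : ℝ) ≤ m := by exact_mod_cast hm
  have h1 := F.sum_a_sq_le
  have haa : 0 ≤ ∑ k, F.a k ^ 2 := Finset.sum_nonneg fun _ _ => sq_nonneg _
  have h2 : 0 ≤ m + 2 * θ := by
    rcases hθ with rfl | ⟨hm2, hθ⟩
    · linarith
    · linarith
  have e : (m - 2 + 2 * θ - 8 * (1 + θ) * F.s⁻¹ ^ 2
        + (2 * θ + m + 2) ^ 2 / m * F.s⁻¹ ^ 2) * ∑ k, F.a k ^ 2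
      + 2 * F.H * ∑ k, F.a k ^ 2 / F.κ k
      = (m + 2 * θ) * ∑ k, F.a k ^ 2
        + (2 * θ - m + 2) ^ 2 / m * F.s⁻¹ ^ 2 * ∑ k, F.a k ^ 2
        + 2 * (F.H * (∑ k, F.a k ^ 2 / F.κ k) - ∑ k, F.a k ^ 2) := by
    have hs := F.s_pos.ne'
    field_simp
    ring
  rw [e]
  have h3 : 0 ≤ F.H * (∑ k, F.a k ^ 2 / F.κ k) - ∑ k, F.a k ^ 2 := by linarith
  positivity

/-- The constant in the differential inequality for the logarithm of the weighted curvature. -/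
def lowerOrderConst (m : ℕ) (θ : ℝ) : ℝ :=
  |2 * (2 * θ + m + 2) / m - 4| + |2 * (2 * θ + 2) / m - 2|

theorem L_logCurv₂_le {θ B : ℝ} (h : F.FirstOrder) (h' : F.SecondOrder) (hm : 1 ≤ m)
    (hθ : θ = -1 / 2 ∨ (2 ≤ m ∧ ((m : ℝ) - 2) / 2 ≤ θ)) (ha : ∀ k, F.s⁻¹ * |F.a k| ≤ B)
    (hH : F.H ≤ B) :
    F.L (F.logCurv₂ θ) ≤ lowerOrderConst m θ * B * ∑ l, |F.logCurv₁ θ l| := by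
  have hm' : (1 : ℝ) ≤ m := by exact_mod_cast hm
  have hs := F.s_pos
  have hw : 0 < 1 + F.s ^ 2 := by positivity
  have hB : 0 ≤ B := F.H_nonneg.trans hH
  set p : Fin m → ℝ := fun k => F.logCurv₁ θ (.inl k) with hp
  set pν := F.logCurv₁ θ (.inr ()) with hpν
  have h1 : ∀ k, (2 * θ + m + 2) ^ 2 / m * F.s⁻¹ ^ 2 * (1 + F.s ^ 2)⁻¹ * F.a k ^ 2
      - 2 * (2 * θ + m + 2) / m * F.s⁻¹ * (F.a k * p k)
      ≤ (1 + F.s ^ 2) * F.s⁻¹ ^ 2 * ∑ i, ∑ j, F.shiftedT k i j ^ 2 / (F.κ i * F.κ j) := by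
    intro k
    have h2 := F.sq_sum_diag_div_le (F.shiftedT k)
    rw [sum_shiftedT_diag F θ] at h2
    have h3 : ((2 * θ + m + 2) * (1 + F.s ^ 2)⁻¹ * F.a k - F.s * p k) ^ 2 / m
        ≤ ∑ i, ∑ j, F.shiftedT k i j ^ 2 / (F.κ i * F.κ j) := by
      rw [div_le_iff₀ (by linarith), mul_comm _ (m : ℝ)]; exact h2
    refine le_trans ?_ (mul_le_mul_of_nonneg_left h3 (by positivity))
    have e : (1 + F.s ^ 2) * F.s⁻¹ ^ 2
          * (((2 * θ + m + 2) * (1 + F.s ^ 2)⁻¹ * F.a k - F.s * p k) ^ 2 / m)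
        = (2 * θ + m + 2) ^ 2 / m * F.s⁻¹ ^ 2 * (1 + F.s ^ 2)⁻¹ * F.a k ^ 2
          - 2 * (2 * θ + m + 2) / m * F.s⁻¹ * (F.a k * p k) + (1 + F.s ^ 2) / m * p k ^ 2 := by
      field_simp
      ring
    rw [e]
    have : 0 ≤ (1 + F.s ^ 2) / m * p k ^ 2 := by positivity
    linarith
  have h2 : (2 * θ + 2) ^ 2 / m * F.H ^ 2 - 2 * (2 * θ + 2) / m * F.H * pν
      ≤ F.s⁻¹ ^ 2 * ∑ i, ∑ j, F.shiftedS i j ^ 2 / (F.κ i * F.κ j) := by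
    have h3 := F.sq_sum_diag_div_le F.shiftedS
    rw [sum_shiftedS_diag F θ] at h3
    have h4 : (F.s * ((2 * θ + 2) * F.H - pν)) ^ 2 / m
        ≤ ∑ i, ∑ j, F.shiftedS i j ^ 2 / (F.κ i * F.κ j) := by
      rw [div_le_iff₀ (by linarith), mul_comm _ (m : ℝ)]; exact h3
    refine le_trans ?_ (mul_le_mul_of_nonneg_left h4 (by positivity))
    have e : F.s⁻¹ ^ 2 * ((F.s * ((2 * θ + 2) * F.H - pν)) ^ 2 / m)
        = (2 * θ + 2) ^ 2 / m * F.H ^ 2 - 2 * (2 * θ + 2) / m * F.H * pν + pν ^ 2 / m := by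
      field_simp
      ring
    rw [e]
    have : 0 ≤ pν ^ 2 / m := by positivity
    linarith
  have h3 := Finset.sum_le_sum fun k (_ : k ∈ Finset.univ) => h1 k
  rw [Finset.sum_sub_distrib, ← Finset.mul_sum, ← Finset.mul_sum, ← Finset.mul_sum] at h3
  have h4 := F.curvature_terms_nonneg hm hθ
  have h5 := mul_nonneg (inv_nonneg.mpr hw.le) (F.mixed_terms_nonneg hm hθ)
  -- The gradient terms combine the cross terms of the squared traces with the linear terms of the
  -- identity; they are the only ones without a sign.
  have h6 : (2 * (2 * θ + m + 2) / m - 4) * (F.s⁻¹ * ∑ k, F.a k * p k)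
      ≤ |2 * (2 * θ + m + 2) / m - 4| * (B * ∑ k, |p k|) := by
    refine (le_abs_self _).trans ?_
    rw [abs_mul]
    refine mul_le_mul_of_nonneg_left ?_ (abs_nonneg _)
    rw [Finset.mul_sum, Finset.mul_sum]
    refine (Finset.abs_sum_le_sum_abs _ _).trans (Finset.sum_le_sum fun k _ => ?_)
    rw [abs_mul, abs_mul, abs_of_pos (inv_pos.mpr hs), ← mul_assoc]
    exact mul_le_mul_of_nonneg_right (ha k) (abs_nonneg _)
  have h7 : (2 * (2 * θ + 2) / m - 2) * (F.H * pν)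
      ≤ |2 * (2 * θ + 2) / m - 2| * (B * |pν|) := by
    refine (le_abs_self _).trans ?_
    rw [abs_mul, abs_mul, abs_of_nonneg F.H_nonneg]
    gcongr
  have h8 : 0 ≤ |2 * (2 * θ + m + 2) / m - 4| * (B * |pν|) := by positivity
  have h9 : 0 ≤ |2 * (2 * θ + 2) / m - 2| * (B * ∑ k, |p k|) :=
    mul_nonneg (abs_nonneg _) (mul_nonneg hB (Finset.sum_nonneg fun _ _ => abs_nonneg _))
  rw [L_logCurv₂ F θ h h', Fintype.sum_sum_unit, lowerOrderConst, ← hpν]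
  change -(_ + _ + _ + _ + 2 * F.H * pν + 4 * F.s⁻¹ * ∑ k, F.a k * p k)
    ≤ _ * (∑ k, |p k| + |pν|)
  linarith

end LevelJet

/-- In two dimensions the weighted curvature with exponent `-1/2` satisfies a linear equation. -/
theorem LevelJet.L_logCurv₂_eq_of_dim_two (F : LevelJet 1) (h : F.FirstOrder)
    (h' : F.SecondOrder) :
    F.L (F.logCurv₂ (-1 / 2)) = -F.L fun l => F.logCurv₁ (-1 / 2) l ^ 2 := by
  have hs := F.s_pos.ne'
  have hw : 1 + F.s ^ 2 ≠ 0 := by positivity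
  have hκ := (F.κ_pos 0).ne'
  have h1 := F.sum_shiftedT_diag (-1 / 2) 0
  have h2 := F.sum_shiftedS_diag (-1 / 2)
  have hH : F.H = F.κ 0 := by simp [LevelJet.H]
  simp only [Finset.univ_unique, Fin.default_eq_zero, Fin.isValue, Finset.sum_singleton,
    Nat.cast_one, hH] at h1 h2
  rw [L_logCurv₂ F _ h h']
  simp only [LevelJet.L, Finset.univ_unique, Fin.default_eq_zero, Fin.isValue,
    Finset.sum_singleton, Nat.cast_one, hH]
  -- With m = 1 each sum of squares is the square of the corresponding trace, so no inequality is
  -- used and the zero order terms cancel exactly.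
  have e1 : F.shiftedT 0 0 0 ^ 2 / (F.κ 0 * F.κ 0) = (F.shiftedT 0 0 0 / F.κ 0) ^ 2 := by
    rw [div_pow, pow_two (F.κ 0)]
  have e2 : F.shiftedS 0 0 ^ 2 / (F.κ 0 * F.κ 0) = (F.shiftedS 0 0 / F.κ 0) ^ 2 := by
    rw [div_pow, pow_two (F.κ 0)]
  rw [e1, e2, h1, h2]
  field_simp
  ring

end LevelJetInequality

/-! ### The frame of principal directions at a point of Ω. -/

section JetOfSolution

variable {n m : ℕ} {u : Euc n → ℝ} {Ω : Set (Euc n)} {x : Euc n}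

/-- `F` consists of the derivatives of `u` at `x` in the orthonormal basis `e`. -/
structure LevelJet.IsJetOf (F : LevelJet m) (u : Euc n → ℝ) (x : Euc n)
    (e : OrthonormalBasis (Fin m ⊕ Unit) ℝ (Euc n)) : Prop where
  norm_gradient : ‖∇ u x‖ = F.s
  gradient : ∀ i, dirDeriv (e i) u x = if i = .inr () then F.s else 0
  hess : ∀ i j, dirDeriv (e j) (dirDeriv (e i) u) x = F.hess i j
  third : ∀ i j k, dirDeriv (e k) (dirDeriv (e j) (dirDeriv (e i) u)) x = F.T i j k
  fourth : ∀ i j k l,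
    dirDeriv (e l) (dirDeriv (e k) (dirDeriv (e j) (dirDeriv (e i) u))) x = F.Q i j k l

theorem dirDeriv_third_comm (hΩ : IsOpen Ω) (hu : ContDiffOn ℝ 4 u Ω) (hx : x ∈ Ω)
    (v w z : Euc n) :
    dirDeriv v (dirDeriv w (dirDeriv z u)) x = dirDeriv v (dirDeriv z (dirDeriv w u)) x :=
  dirDeriv_congr hΩ (fun _ hy => dirDeriv_comm hΩ (hu.of_le (by norm_num)) w z hy) v hx

theorem dirDeriv_fourth_comm (hΩ : IsOpen Ω) (hu : ContDiffOn ℝ 4 u Ω) (hx : x ∈ Ω)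
    (v w : Euc n) :
    dirDeriv v (dirDeriv v (dirDeriv w (dirDeriv w u))) x
      = dirDeriv w (dirDeriv w (dirDeriv v (dirDeriv v u))) x := by
  have h3 : ∀ z, ContDiffOn ℝ 3 (dirDeriv z u) Ω := fun z => hu.dirDeriv hΩ (by norm_num) z
  have h2 : ∀ z z', ContDiffOn ℝ 2 (dirDeriv z (dirDeriv z' u)) Ω := fun z z' =>
    (h3 z').dirDeriv hΩ (by norm_num) z
  rw [dirDeriv_congr hΩ (fun y hy => dirDeriv_comm hΩ ((h3 w).of_le (by norm_num)) v w hy) v hx,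
    dirDeriv_comm hΩ (h2 v w) v w hx]
  refine dirDeriv_congr hΩ (fun y hy => ?_) w hx
  rw [dirDeriv_third_comm hΩ hu hy, dirDeriv_comm hΩ ((h3 v).of_le (by norm_num)) v w hy]

theorem levelShapeOp_isSymmetric {g : Euc n} {A : Euc n →L[ℝ] Euc n}
    (hA : ∀ v w, inner ℝ v (A w) = inner ℝ w (A v)) : (levelShapeOp g A).IsSymmetric := by
  have h : ∀ v w : (ℝ ∙ g)ᗮ,
      inner ℝ v (levelShapeOp g A w) = -‖g‖⁻¹ * inner ℝ (v : Euc n) (A w) := fun v w => by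
    rw [levelShapeOp, LinearMap.smul_apply, inner_smul_right]
    congr 1
    exact Submodule.inner_orthogonalProjectionOnto_eq_of_mem_left _ _
  intro v w
  rw [real_inner_comm, h, h, hA]

theorem levelGaussCurv_pos {g : Euc n} {A : Euc n →L[ℝ] Euc n}
    (hA : ∀ v w, inner ℝ v (A w) = inner ℝ w (A v))
    (hpos : ∀ X : (ℝ ∙ g)ᗮ, X ≠ 0 → 0 < inner ℝ (levelShapeOp g A X) X) :
    0 < levelGaussCurv g A := by
  have hS := levelShapeOp_isSymmetric (g := g) hA
  rw [levelGaussCurv, hS.det_eq_prod_eigenvalues rfl]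
  refine Finset.prod_pos fun i _ => ?_
  have h := hpos (hS.eigenvectorBasis rfl i) ((hS.eigenvectorBasis rfl).orthonormal.ne_zero i)
  rw [hS.apply_eigenvectorBasis, inner_smul_left, real_inner_self_eq_norm_sq,
    (hS.eigenvectorBasis rfl).norm_eq_one] at h
  simpa using h

/-- At a point of `Ω`, principal directions of the level set and its normal form a frame in which
the derivatives of `u` make up a `LevelJet`. -/
theorem exists_isJetOf (hn : n = m + 1) (hΩ : IsOpen Ω) (hu : ContDiffOn ℝ 4 u Ω)
    (hmin : SolvesMinimalSurfaceEq Ω u) (hx : x ∈ Ω) (hg : ∇ u x ≠ 0)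
    (hpos : ∀ X : (ℝ ∙ (∇ u x))ᗮ, X ≠ 0 →
      0 < inner ℝ (levelShapeOp (∇ u x) (hessianOp u x) X) X) :
    ∃ (e : OrthonormalBasis (Fin m ⊕ Unit) ℝ (Euc n)) (F : LevelJet m), F.IsJetOf u x e := by
  have hu2 : ContDiffOn ℝ 2 u Ω := hu.of_le (by norm_num)
  have hsym := inner_hessianOp_symm hΩ hu2 hx
  set g := ∇ u x with hgdef
  set A := hessianOp u x
  have hs : 0 < ‖g‖ := norm_pos_iff.mpr hg
  have : Fact (Module.finrank ℝ (Euc n) = m + 1) := ⟨by simp [hn]⟩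
  have hfr : Module.finrank ℝ (ℝ ∙ g)ᗮ = m := Submodule.finrank_orthogonal_span_singleton hg
  have hS := levelShapeOp_isSymmetric (g := g) hsym
  set b := hS.eigenvectorBasis hfr with hb
  set κ := hS.eigenvalues hfr with hκ
  have hSb : ∀ i, levelShapeOp g A (b i) = κ i • b i := fun i =>
    hS.apply_eigenvectorBasis hfr i
  have hκpos : ∀ i, 0 < κ i := fun i => by
    have h := hpos (b i) (b.orthonormal.ne_zero i)
    rw [hSb, inner_smul_left, real_inner_self_eq_norm_sq, b.norm_eq_one] at h
    simpa using h
  obtain ⟨e, he, hν⟩ := exists_adapted_orthonormalBasis hg b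
  have hgrad : ∀ i, dirDeriv (e i) u x = if i = .inr () then ‖g‖ else 0 := by
    intro i
    rw [← inner_gradient_eq_dirDeriv, ← hgdef]
    rcases i with i | i
    · rw [he]
      simpa using Submodule.mem_orthogonal_singleton_iff_inner_left.mp (b i).2
    · rw [show e (.inr i) = ‖g‖⁻¹ • g from hν, inner_smul_left, real_inner_self_eq_norm_sq]
      simp; field_simp
  have hD : ∀ i j, dirDeriv (e j) (dirDeriv (e i) u) x = inner ℝ (e i) (A (e j)) := fun i j =>
    (inner_hessianOp_eq_dirDeriv hΩ hu2 hx _ _).symm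
  have htan : ∀ i j, inner ℝ (e (.inl i)) (A (e (.inl j)))
      = if i = j then -(‖g‖ * κ i) else 0 := by
    intro i j
    have h1 : inner ℝ (b i) (levelShapeOp g A (b j))
        = -‖g‖⁻¹ * inner ℝ (b i : Euc n) (A (b j)) := by
      rw [levelShapeOp, LinearMap.smul_apply, inner_smul_right]
      congr 1
      exact Submodule.inner_orthogonalProjectionOnto_eq_of_mem_left _ _
    rw [hSb, inner_smul_right, orthonormal_iff_ite.mp b.orthonormal] at h1
    rw [he, he]
    split_ifs at h1 ⊢ with h
    · subst h; field_simp at h1; linarith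
    · field_simp at h1; linarith
  refine ⟨e, ⟨‖g‖, κ, fun i => inner ℝ (e (.inl i)) (A (e (.inr ()))),
    fun i j k => dirDeriv (e k) (dirDeriv (e j) (dirDeriv (e i) u)) x,
    fun i j k l => dirDeriv (e l) (dirDeriv (e k) (dirDeriv (e j) (dirDeriv (e i) u))) x,
    hs, hκpos, fun i j k => dirDeriv_third_comm hΩ hu hx _ _ _, fun i j k => ?_,
    fun i j => dirDeriv_fourth_comm hΩ hu hx _ _⟩, rfl, hgrad, ?_, fun _ _ _ => rfl,
    fun _ _ _ _ => rfl⟩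
  · exact dirDeriv_comm hΩ ((hu.dirDeriv hΩ (j := 3) (by norm_num) _).of_le (by norm_num)) _ _ hx
  · rintro (i | i) (j | j)
    · rw [hD, htan]; rfl
    · rw [hD]; rfl
    · rw [hD, hsym]; rfl
    -- In this frame the equation reads (1 + s²)(c - s H) - s² c = 0, which determines c.
    · have hE := hmin.nondivergence hΩ hu2 e hx
      simp only [hgrad, hD] at hE
      simp only [Fintype.sum_sum_unit, htan, if_true, reduceCtorEq, if_false, mul_zero, zero_mul,
        Finset.sum_const_zero, zero_add, Finset.sum_neg_distrib, ← Finset.mul_sum] at hE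
      rw [hD]
      change inner ℝ (e (.inr ())) (A (e (.inr ()))) = ‖g‖ * (1 + ‖g‖ ^ 2) * ∑ i, κ i
      linarith

namespace LevelJet.IsJetOf

variable {F : LevelJet m} {e : OrthonormalBasis (Fin m ⊕ Unit) ℝ (Euc n)}

theorem hasJet_gradient (hF : F.IsJetOf u x e) (hΩ : IsOpen Ω) (hu : ContDiffOn ℝ 4 u Ω)
    (hx : x ∈ Ω) (i l : Fin m ⊕ Unit) :
    HasJet (fun t => dirDeriv (e i) u (x + t • e l)) (if i = .inr () then F.s else 0)
      (F.hess i l) (F.T i l l) :=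
  (hasJet_line hΩ ((hu.dirDeriv hΩ (j := 3) (by norm_num) (e i)).of_le (by norm_num)) (e l)
    hx).congr (hF.gradient i) (hF.hess i l) (hF.third i l l)

theorem hasJet_hess (hF : F.IsJetOf u x e) (hΩ : IsOpen Ω) (hu : ContDiffOn ℝ 4 u Ω)
    (hx : x ∈ Ω) (i j l : Fin m ⊕ Unit) :
    HasJet (fun t => dirDeriv (e j) (dirDeriv (e i) u) (x + t • e l)) (F.hess i j)
      (F.T i j l) (F.Q i j l l) :=
  (hasJet_line hΩ ((hu.dirDeriv hΩ (j := 3) (by norm_num) (e i)).dirDeriv hΩ (by norm_num) (e j))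
    (e l) hx).congr (hF.hess i j) (hF.third i j l) (hF.fourth i j l l)

theorem hess_symm (F : LevelJet m) (i j : Fin m ⊕ Unit) : F.hess i j = F.hess j i := by
  rcases i with i | i <;> rcases j with j | j
  · simp only [LevelJet.hess]
    by_cases h : i = j
    · subst h; rfl
    · simp [h, Ne.symm h]
  all_goals rfl

theorem equations (hF : F.IsJetOf u x e) (hΩ : IsOpen Ω) (hu : ContDiffOn ℝ 4 u Ω)
    (hmin : SolvesMinimalSurfaceEq Ω u) (hx : x ∈ Ω) : F.FirstOrder ∧ F.SecondOrder := by
  have h := fun l => minimalSurface_jets (hF.hasJet_gradient hΩ hu hx · l)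
    (hF.hasJet_hess hΩ hu hx · · l) (hess_symm F) (fun i j => F.T_swap_left i j l)
    ((eventually_line_mem hΩ hx (e l)).mono fun t ht =>
      hmin.nondivergence hΩ (hu.of_le (by norm_num)) e ht)
  exact ⟨fun l => (h l).1, fun l => (h l).2⟩

theorem hasJet_norm_gradient_sq (hF : F.IsJetOf u x e) (hΩ : IsOpen Ω) (hu : ContDiffOn ℝ 4 u Ω)
    (hx : x ∈ Ω) (l : Fin m ⊕ Unit) :
    HasJet (fun t => ‖∇ u (x + t • e l)‖ ^ 2) (F.s ^ 2) (F.gradSq₁ l) (F.gradSq₂ l) := by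
  have h : (fun t : ℝ => ‖∇ u (x + t • e l)‖ ^ 2)
      = fun t => ∑ i, dirDeriv (e i) u (x + t • e l) * dirDeriv (e i) u (x + t • e l) := by
    funext t
    rw [← real_inner_self_eq_norm_sq, ← e.sum_inner_mul_inner]
    refine Finset.sum_congr rfl fun i _ => ?_
    rw [real_inner_comm, inner_gradient_eq_dirDeriv]
  rw [h]
  refine (HasJet.sum Finset.univ fun i _ => (hF.hasJet_gradient hΩ hu hx i l).mul
    (hF.hasJet_gradient hΩ hu hx i l)).congr ?_ ?_ ?_
  · simp [pow_two]
  · simp [gradSq₁, Finset.sum_add_distrib]; ring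
  · simp only [gradSq₂, Finset.sum_add_distrib, mul_ite, ite_mul, mul_zero, zero_mul,
      Finset.sum_ite_eq', Finset.mem_univ, if_true, ← Finset.mul_sum, pow_two]
    ring

end LevelJet.IsJetOf

end JetOfSolution

/-! ### Jets of the logarithm of the weighted curvature. -/

noncomputable section LogCurvature

variable {n m : ℕ} {u : Euc n → ℝ} {Ω : Set (Euc n)} {x : Euc n}

theorem borderedForm_eq_dirDeriv (hΩ : IsOpen Ω) (hu : ContDiffOn ℝ 2 u Ω) (hx : x ∈ Ω)
    (v w : Euc n × ℝ) :
    borderedForm (∇ u x) (hessianOp u x) v w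
      = dirDeriv w.1 (dirDeriv v.1 u) x + v.2 * dirDeriv w.1 u x + w.2 * dirDeriv v.1 u x := by
  rw [borderedForm_apply, inner_hessianOp_eq_dirDeriv hΩ hu hx, real_inner_comm,
    inner_gradient_eq_dirDeriv, real_inner_comm, inner_gradient_eq_dirDeriv]

theorem dirDeriv_zero_left (f : Euc n → ℝ) : dirDeriv 0 f = fun _ => 0 := by
  funext y; simp [dirDeriv]

theorem dirDeriv_zero_right (v : Euc n) : dirDeriv v (fun _ : Euc n => (0 : ℝ)) = fun _ => 0 := by
  funext y; simp [dirDeriv]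

namespace LevelJet

/-- The frame of `ℝⁿ × ℝ` in which the bordered Hessian is block diagonal. -/
def borderedFrame (F : LevelJet m) (e : OrthonormalBasis (Fin m ⊕ Unit) ℝ (Euc n)) :
    Fin m ⊕ Fin 2 → Euc n × ℝ :=
  -- The border vector pairs with ν to s and with the tangent vectors to 0. Hence -a_i/s of it
  -- cancels the mixed entry a_i, and -c/(2s), counted twice by symmetry, cancels c.
  Sum.elim (fun i => (e (.inl i), -(F.a i / F.s))) ![(e (.inr ()), -(F.c / (2 * F.s))), (0, 1)]

/-- The bordered matrix with gradient part `g` and Hessian part `A`, in the frame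
`borderedFrame`. -/
def borderedBlocks (F : LevelJet m) (g : Fin m ⊕ Unit → ℝ)
    (A : Fin m ⊕ Unit → Fin m ⊕ Unit → ℝ) : Matrix (Fin m ⊕ Fin 2) (Fin m ⊕ Fin 2) ℝ :=
  Matrix.fromBlocks
    (Matrix.of fun i j => A (.inl i) (.inl j) - F.a i / F.s * g (.inl j) - F.a j / F.s * g (.inl i))
    (Matrix.of fun i b => ![A (.inl i) (.inr ()) - F.a i / F.s * g (.inr ())
      - F.c / (2 * F.s) * g (.inl i), g (.inl i)] b)
    (Matrix.of fun b i => ![A (.inl i) (.inr ()) - F.a i / F.s * g (.inr ())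
      - F.c / (2 * F.s) * g (.inl i), g (.inl i)] b)
    !![A (.inr ()) (.inr ()) - F.c / F.s * g (.inr ()), g (.inr ()); g (.inr ()), 0]

/-- Stated for abstract β and γ so that it serves for the bordered form and for its first and second
derivatives, the frame being constant along the line. Additivity is not needed: the first components
are basis vectors or 0. -/
theorem borderedBlocks_apply (F : LevelJet m) {e : OrthonormalBasis (Fin m ⊕ Unit) ℝ (Euc n)}
    {β : Euc n → Euc n → ℝ} {γ : Euc n → ℝ} (hβ : ∀ v w, β v w = β w v) (hβ0 : ∀ v, β v 0 = 0)
    (hγ : γ 0 = 0) (I J : Fin m ⊕ Fin 2) :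
    β (F.borderedFrame e I).1 (F.borderedFrame e J).1
        + (F.borderedFrame e I).2 * γ (F.borderedFrame e J).1
        + (F.borderedFrame e J).2 * γ (F.borderedFrame e I).1
      = F.borderedBlocks (fun i => γ (e i)) (fun i j => β (e i) (e j)) I J := by
  have hβ0' : ∀ v, β 0 v = 0 := fun v => by rw [hβ, hβ0]
  have hs := F.s_pos.ne'
  rcases I with i | i <;> rcases J with j | j
  · simp [borderedFrame, borderedBlocks]; ring
  · fin_cases j <;> simp [borderedFrame, borderedBlocks, hβ0, hγ]
    ring
  · fin_cases i <;> simp [borderedFrame, borderedBlocks, hβ0', hγ]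
    rw [hβ]; ring
  · fin_cases i <;> fin_cases j <;> simp [borderedFrame, borderedBlocks, hβ0, hβ0', hγ]
    field_simp; ring

/-- The inverse of the bordered matrix in the frame `borderedFrame`. -/
def borderedInv (F : LevelJet m) : Matrix (Fin m ⊕ Fin 2) (Fin m ⊕ Fin 2) ℝ :=
  Matrix.fromBlocks (Matrix.diagonal fun i => -(F.s * F.κ i)⁻¹) 0 0 !![0, F.s⁻¹; F.s⁻¹, 0]

theorem borderedBlocks_mul_borderedInv (F : LevelJet m) :
    F.borderedBlocks (fun i => if i = .inr () then F.s else 0) F.hess * F.borderedInv = 1 := by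
  have hs := F.s_pos.ne'
  have h : F.borderedBlocks (fun i => if i = .inr () then F.s else 0) F.hess
      = Matrix.fromBlocks (Matrix.diagonal fun i => -(F.s * F.κ i)) 0 0 !![0, F.s; F.s, 0] := by
    rw [borderedBlocks]
    congr 1
    · ext i j
      simp [hess, Matrix.diagonal_apply]
    · ext i b; fin_cases b <;> simp [hess]; field_simp; ring
    · ext b i; fin_cases b <;> simp [hess]; field_simp; ring
    · simp [hess, hs]
  rw [h, borderedInv, Matrix.fromBlocks_multiply, ← Matrix.fromBlocks_one]
  congr 1
  · simp only [Matrix.mul_zero, add_zero, Matrix.diagonal_mul_diagonal, ← Matrix.diagonal_one]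
    congr 1
    funext i
    have := (F.κ_pos i).ne'
    field_simp
  · simp
  · simp
  · ext i j; fin_cases i <;> fin_cases j <;> simp [hs]

namespace IsJetOf

variable {F : LevelJet m} {e : OrthonormalBasis (Fin m ⊕ Unit) ℝ (Euc n)}

theorem hasJet_borderedGram (hF : F.IsJetOf u x e) (hΩ : IsOpen Ω) (hu : ContDiffOn ℝ 4 u Ω)
    (hx : x ∈ Ω) (l : Fin m ⊕ Unit) (I J : Fin m ⊕ Fin 2) :
    HasJet (fun t => borderedGram (F.borderedFrame e) (∇ u (x + t • e l))
        (hessianOp u (x + t • e l)) I J)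
      (F.borderedBlocks (fun i => if i = .inr () then F.s else 0) F.hess I J)
      (F.borderedBlocks (fun i => F.hess i l) (fun i j => F.T i j l) I J)
      (F.borderedBlocks (fun i => F.T i l l) (fun i j => F.Q i j l l) I J) := by
  have hu2 : ContDiffOn ℝ 2 u Ω := hu.of_le (by norm_num)
  have h1 : ∀ v, ContDiffOn ℝ 3 (dirDeriv v u) Ω := fun v => hu.dirDeriv hΩ (by norm_num) v
  have h2 : ∀ v w, ContDiffOn ℝ 2 (dirDeriv w (dirDeriv v u)) Ω := fun v w =>
    (h1 v).dirDeriv hΩ (by norm_num) w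
  have hγ : ∀ v, HasJet (fun t => dirDeriv v u (x + t • e l)) (dirDeriv v u x) _ _ := fun v =>
    hasJet_line hΩ ((h1 v).of_le (by norm_num)) (e l) hx
  have hβ : ∀ v w, HasJet (fun t => dirDeriv w (dirDeriv v u) (x + t • e l)) _ _ _ := fun v w =>
    hasJet_line hΩ (h2 v w) (e l) hx
  set P := F.borderedFrame e
  have h := ((hβ (P I).1 (P J).1).add ((hγ (P J).1).const_mul (P I).2)).add
    ((hγ (P I).1).const_mul (P J).2)
  have comm0 : ∀ v w, EqOn (dirDeriv w (dirDeriv v u)) (dirDeriv v (dirDeriv w u)) Ω :=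
    fun v w y hy => dirDeriv_comm hΩ hu2 w v hy
  have comm1 : ∀ v w, EqOn (dirDeriv (e l) (dirDeriv w (dirDeriv v u)))
      (dirDeriv (e l) (dirDeriv v (dirDeriv w u))) Ω := fun v w y hy =>
    dirDeriv_congr hΩ (comm0 v w) (e l) hy
  have comm2 : ∀ v w, dirDeriv (e l) (dirDeriv (e l) (dirDeriv w (dirDeriv v u))) x
      = dirDeriv (e l) (dirDeriv (e l) (dirDeriv v (dirDeriv w u))) x := fun v w =>
    dirDeriv_congr hΩ (comm1 v w) (e l) hx
  have e0 := F.borderedBlocks_apply (e := e) (β := fun v w => dirDeriv w (dirDeriv v u) x)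
    (γ := fun v => dirDeriv v u x) (fun v w => comm0 v w hx)
    (fun v => by simp [dirDeriv_zero_left]) (by simp [dirDeriv_zero_left]) I J
  have e1 := F.borderedBlocks_apply (e := e)
    (β := fun v w => dirDeriv (e l) (dirDeriv w (dirDeriv v u)) x)
    (γ := fun v => dirDeriv (e l) (dirDeriv v u) x) (fun v w => comm1 v w hx)
    (fun v => by simp [dirDeriv_zero_left, dirDeriv_zero_right])
    (by simp [dirDeriv_zero_left, dirDeriv_zero_right]) I J
  have e2 := F.borderedBlocks_apply (e := e)
    (β := fun v w => dirDeriv (e l) (dirDeriv (e l) (dirDeriv w (dirDeriv v u))) x)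
    (γ := fun v => dirDeriv (e l) (dirDeriv (e l) (dirDeriv v u)) x) (fun v w => comm2 v w)
    (fun v => by simp [dirDeriv_zero_left, dirDeriv_zero_right])
    (by simp [dirDeriv_zero_left, dirDeriv_zero_right]) I J
  simp only [hF.gradient, hF.hess] at e0
  simp only [hF.hess, hF.third] at e1
  simp only [hF.third, hF.fourth] at e2
  refine (h.congr e0 e1 e2).congr_of_eventuallyEq ?_
  filter_upwards [eventually_line_mem hΩ hx (e l)] with t ht
  exact borderedForm_eq_dirDeriv hΩ hu2 ht _ _

theorem hasJet_log_det (hF : F.IsJetOf u x e) (hΩ : IsOpen Ω) (hu : ContDiffOn ℝ 4 u Ω)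
    (hx : x ∈ Ω) (l : Fin m ⊕ Unit) :
    HasJet (fun t => Real.log (borderedGram (F.borderedFrame e) (∇ u (x + t • e l))
        (hessianOp u (x + t • e l))).det)
      (Real.log (F.borderedBlocks (fun i => if i = .inr () then F.s else 0) F.hess).det)
      (F.logDet₁ l) (F.logDet₂ l) := by
  refine (HasJet.log_det (hF.hasJet_borderedGram hΩ hu hx l)
    F.borderedBlocks_mul_borderedInv).congr rfl ?_ ?_
  · rw [borderedInv, borderedBlocks, trace_blockDiagonal_mul, logDet₁]
    rfl
  · have hS : ∀ i j, (Matrix.of fun i j => F.T (.inl i) (.inl j) l - F.a i / F.s * F.hess (.inl j) l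
        - F.a j / F.s * F.hess (.inl i) l : Matrix (Fin m) (Fin m) ℝ) i j
        = (Matrix.of fun i j => F.T (.inl i) (.inl j) l - F.a i / F.s * F.hess (.inl j) l
        - F.a j / F.s * F.hess (.inl i) l : Matrix (Fin m) (Fin m) ℝ) j i := fun i j => by
      simp only [Matrix.of_apply, F.T_swap_left (.inl i)]; ring
    rw [borderedInv, borderedBlocks, borderedBlocks, trace_blockDiagonal_mul,
      trace_blockDiagonal_mul_sq _ _ _ hS, logDet₂]
    rfl

end IsJetOf

end LevelJet

/-- The logarithm of the weighted curvature. -/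
def logCurv (θ : ℝ) (u : Euc n → ℝ) (x : Euc n) : ℝ :=
  Real.log (levelGaussCurv (∇ u x) (hessianOp u x))
    + θ * (Real.log (‖∇ u x‖ ^ 2) - Real.log (1 + ‖∇ u x‖ ^ 2))

theorem LevelJet.IsJetOf.hasJet_logCurv {F : LevelJet m}
    {e : OrthonormalBasis (Fin m ⊕ Unit) ℝ (Euc n)} (hF : F.IsJetOf u x e) (hn : n = m + 1)
    (hΩ : IsOpen Ω) (hu : ContDiffOn ℝ 4 u Ω) (hgrad : ∀ y ∈ Ω, ∇ u y ≠ 0)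
    (hK : ∀ y ∈ Ω, 0 < levelGaussCurv (∇ u y) (hessianOp u y)) (hx : x ∈ Ω) (θ : ℝ)
    (l : Fin m ⊕ Unit) :
    HasJet (fun t => logCurv θ u (x + t • e l)) (logCurv θ u x) (F.logCurv₁ θ l)
      (F.logCurv₂ θ l) := by
  obtain ⟨c, hc⟩ := exists_det_borderedGram_eq hn e (F.borderedFrame e)
  have hD := hF.hasJet_log_det hΩ hu hx l
  have hG := hF.hasJet_norm_gradient_sq hΩ hu hx l
  have hs := F.s_pos
  -- The matrix is invertible at `x`, so its determinant is not 0.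
  have hc0 : c ≠ 0 := by
    rintro rfl
    have h1 : borderedGram (F.borderedFrame e) (∇ u x) (hessianOp u x)
        = F.borderedBlocks (fun i => if i = .inr () then F.s else 0) F.hess := by
      ext I J
      simpa using (hF.hasJet_borderedGram hΩ hu hx l I J).val
    have h2 := congrArg Matrix.det F.borderedBlocks_mul_borderedInv
    rw [Matrix.det_mul, ← h1, hc _ _ (hgrad x hx)] at h2
    simp at h2
  have h := ((hD.sub (HasJet.const (Real.log c))).add
    ((hG.log (by positivity)).const_mul (θ - (m + 2) / 2))).sub
      ((((HasJet.const 1).add hG).log (by positivity)).const_mul θ)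
  -- The determinant and `c` may be negative; `Real.log` is the logarithm of the absolute value, so
  -- the product rule for logarithms still applies.
  have hev : (fun t : ℝ => logCurv θ u (x + t • e l)) =ᶠ[𝓝 0] fun t =>
      Real.log (borderedGram (F.borderedFrame e)
        (∇ u (x + t • e l)) (hessianOp u (x + t • e l))).det - Real.log c
        + (θ - (m + 2) / 2) * Real.log (‖∇ u (x + t • e l)‖ ^ 2)
        - θ * Real.log (1 + ‖∇ u (x + t • e l)‖ ^ 2) := by
    filter_upwards [eventually_line_mem hΩ hx (e l)] with t ht
    have hg := norm_pos_iff.mpr (hgrad _ ht)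
    have hK' := hK _ ht
    rw [hc _ _ (hgrad _ ht), Real.log_mul hc0 (by positivity), Real.log_mul (by positivity)
      hK'.ne', Real.log_pow, Real.log_pow, logCurv, Real.log_pow]
    push_cast
    ring
  have h' := h.congr_of_eventuallyEq hev
  have hval := h'.val
  refine h'.congr ?_ ?_ ?_
  · rw [← hval]; simp
  · simp only [LevelJet.logCurv₁]; ring
  · simp only [LevelJet.logCurv₂]; ring

end LogCurvature

/-! ### From the absence of interior extrema to extrema on the boundary. -/

section BoundaryExtrema

variable {n : ℕ} {Ω R : Set (Euc n)} {f : Euc n → ℝ}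

theorem constantOn_of_eqOn (hΩR : Ω ⊆ R) (hR : R ⊆ closure Ω) (hf : ContinuousOn f R) {c : ℝ}
    (h : ∀ x ∈ Ω, f x = c) : ConstantOn R f := by
  refine ⟨c, fun x hx => ?_⟩
  have : (𝓝[Ω] x).NeBot := mem_closure_iff_nhdsWithin_neBot.mp (hR hx)
  have h1 : Tendsto f (𝓝[Ω] x) (𝓝 (f x)) := (hf x hx).mono_left (nhdsWithin_mono _ hΩR)
  have h2 : Tendsto f (𝓝[Ω] x) (𝓝 c) :=
    tendsto_const_nhds.congr' (by filter_upwards [self_mem_nhdsWithin] with y hy using (h y hy).symm)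
  exact tendsto_nhds_unique h1 h2

/-- A continuous function without minimum in `Ω` attains its minimum on the boundary only. -/
theorem minOnBoundary_of_forall_exists_lt (hΩ : IsOpen Ω) (hne : Ω.Nonempty)
    (hb : Bornology.IsBounded Ω) (hΩR : Ω ⊆ R) (hR : R ⊆ closure Ω) (hf : ContinuousOn f R)
    (hlt : ∀ y ∈ Ω, ∃ x ∈ Ω, f x < f y) : MinOnBoundary Ω R f := by
  have hnonempty : Nonempty Ω := hne.to_subtype
  -- The sublevel sets are nested and nonempty, so they generate a proper filter, which has a
  -- cluster point in the compact closure of Ω. Every sublevel set comes arbitrarily close to this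
  -- point.
  let 𝓕 : Filter (Euc n) := ⨅ y : Ω, 𝓟 {x ∈ Ω | f x < f y}
  have hmem : ∀ y ∈ Ω, {x ∈ Ω | f x < f y} ∈ 𝓕 := fun y hy =>
    mem_iInf_of_mem (⟨y, hy⟩ : Ω) (mem_principal_self _)
  have hNe : 𝓕.NeBot := by
    refine iInf_neBot_of_directed ?_ fun y => ?_
    · intro y y'
      rcases le_total (f y) (f y') with h | h
      · exact ⟨y, le_refl _, principal_mono.mpr fun x hx => ⟨hx.1, hx.2.trans_le h⟩⟩
      · exact ⟨y', principal_mono.mpr fun x hx => ⟨hx.1, hx.2.trans_le h⟩, le_refl _⟩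
    · obtain ⟨x, hx, hxy⟩ := hlt y y.2
      exact principal_neBot_iff.mpr ⟨x, hx, hxy⟩
  obtain ⟨y₀, hy₀⟩ := hne
  have hle : 𝓕 ≤ 𝓟 (closure Ω) := by
    rw [le_principal_iff]
    exact mem_of_superset (hmem y₀ hy₀) fun x hx => subset_closure hx.1
  obtain ⟨p, hp, hcl⟩ := hb.isCompact_closure.exists_clusterPt hle
  have hfreq : ∀ y ∈ Ω, ∃ᶠ x in 𝓝[Ω] p, f x < f y := by
    intro y hy
    have h1 : ClusterPt p (𝓟 {x ∈ Ω | f x < f y}) := hcl.mono (le_principal_iff.mpr (hmem y hy))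
    rw [← mem_closure_iff_clusterPt, mem_closure_iff_frequently] at h1
    rw [frequently_nhdsWithin_iff]
    exact h1.mono fun x hx => ⟨hx.2, hx.1⟩
  have hple : p ∈ R → ∀ y ∈ Ω, f p ≤ f y := by
    intro hpR y hy
    by_contra! hcon
    have h1 : Tendsto f (𝓝[Ω] p) (𝓝 (f p)) := (hf p hpR).mono_left (nhdsWithin_mono _ hΩR)
    exact hfreq y hy ((h1.eventually_const_lt hcon).mono fun x hx => hx.le.not_gt)
  have hpΩ : p ∉ Ω := by
    intro hpΩ
    obtain ⟨y, hy, hyp⟩ := hlt p hpΩ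
    exact absurd (hple (hΩR hpΩ) y hy) hyp.not_ge
  refine ⟨p, by rw [hΩ.frontier_eq]; exact ⟨hp, hpΩ⟩, hfreq, fun hpR => ⟨fun y hy => ?_, fun y hy => ?_⟩⟩
  · have : (𝓝[Ω] y).NeBot := mem_closure_iff_nhdsWithin_neBot.mp (hR hy)
    have h1 : Tendsto f (𝓝[Ω] y) (𝓝 (f y)) := (hf y hy).mono_left (nhdsWithin_mono _ hΩR)
    refine ge_of_tendsto h1 ?_
    filter_upwards [self_mem_nhdsWithin] with x hx using hple hpR x hx
  · obtain ⟨x, hx, hxy⟩ := hlt y hy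
    exact (hple hpR x hx).trans_lt hxy

theorem constantOn_or_minOnBoundary (hΩ : IsOpen Ω) (hne : Ω.Nonempty)
    (hb : Bornology.IsBounded Ω) (hΩR : Ω ⊆ R) (hR : R ⊆ closure Ω) (hf : ContinuousOn f R)
    (hstrong : ∀ z ∈ Ω, (∀ x ∈ Ω, f z ≤ f x) → ∀ x ∈ Ω, f x = f z) :
    ConstantOn R f ∨ MinOnBoundary Ω R f := by
  by_cases h : ∃ z ∈ Ω, ∀ x ∈ Ω, f z ≤ f x
  · obtain ⟨z, hz, hzm⟩ := h
    exact .inl (constantOn_of_eqOn hΩR hR hf (hstrong z hz hzm))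
  · push Not at h
    exact .inr (minOnBoundary_of_forall_exists_lt hΩ hne hb hΩR hR hf h)

theorem constantOn_or_maxOnBoundary (hΩ : IsOpen Ω) (hne : Ω.Nonempty)
    (hb : Bornology.IsBounded Ω) (hΩR : Ω ⊆ R) (hR : R ⊆ closure Ω) (hf : ContinuousOn f R)
    (hstrong : ∀ z ∈ Ω, (∀ x ∈ Ω, -f z ≤ -f x) → ∀ x ∈ Ω, -f x = -f z) :
    ConstantOn R f ∨ MaxOnBoundary Ω R f := by
  rcases constantOn_or_minOnBoundary hΩ hne hb hΩR hR hf.neg hstrong with ⟨c, hc⟩ | ⟨p, hp, h1, h2⟩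
  · exact .inl ⟨-c, fun x hx => neg_eq_iff_eq_neg.mp (hc x hx)⟩
  · exact .inr ⟨p, hp, fun y hy => (h1 y hy).mono fun x hx => neg_lt_neg_iff.mp hx,
      fun hpR => ⟨fun y hy => neg_le_neg_iff.mp ((h2 hpR).1 y hy),
        fun y hy => neg_lt_neg_iff.mp ((h2 hpR).2 y hy)⟩⟩

end BoundaryExtrema

/-! ### Continuity of the weighted curvature up to the boundary. -/

section WeightedCurvature

variable {n m : ℕ} {u : Euc n → ℝ} {Ω : Set (Euc n)}

/-- The shape operator lives on a space that varies with `g`; this formula in a fixed frame makes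
the continuity of K visible. -/
theorem levelGaussCurv_eq_det_div (hn : n = m + 1)
    (e : OrthonormalBasis (Fin m ⊕ Unit) ℝ (Euc n)) {g : Euc n} (hg : g ≠ 0)
    (A : Euc n →L[ℝ] Euc n) :
    levelGaussCurv g A = -(-1) ^ m * (borderedGram (prodFrame e) g A).det / ‖g‖ ^ (m + 2) := by
  have : Fact (Module.finrank ℝ (Euc n) = m + 1) := ⟨by simp [hn]⟩
  have hfr : Module.finrank ℝ (ℝ ∙ g)ᗮ = m := Submodule.finrank_orthogonal_span_singleton hg
  obtain ⟨e', he', hν'⟩ := exists_adapted_orthonormalBasis hg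
    ((stdOrthonormalBasis ℝ (ℝ ∙ g)ᗮ).reindex (finCongr hfr))
  have hn : ‖g‖ ≠ 0 := norm_ne_zero_iff.mpr hg
  rw [← det_borderedGram_prodFrame_eq e e', det_borderedGram_adapted hg A _ he' hν']
  have h : (-1 : ℝ) ^ m * (-1) ^ m = 1 := by rw [← mul_pow]; simp
  field_simp
  linear_combination (-levelGaussCurv g A) * h

theorem continuousOn_levelGaussCurv (hn : n = m + 1) :
    ContinuousOn (fun p : Euc n × (Euc n →L[ℝ] Euc n) => levelGaussCurv p.1 p.2)
      {p | p.1 ≠ 0} := by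
  have hcard : Fintype.card (Fin (Module.finrank ℝ (Euc n))) = Fintype.card (Fin m ⊕ Unit) := by
    simp [hn]
  have e := (stdOrthonormalBasis ℝ (Euc n)).reindex (Fintype.equivOfCardEq hcard)
  have h : ContinuousOn (fun p : Euc n × (Euc n →L[ℝ] Euc n) =>
      -(-1) ^ m * (borderedGram (prodFrame e) p.1 p.2).det / ‖p.1‖ ^ (m + 2)) {p | p.1 ≠ 0} := by
    refine ContinuousOn.div ?_ (by fun_prop)
      fun p hp => pow_ne_zero _ (norm_ne_zero_iff.mpr hp)
    refine (continuous_const.mul (Continuous.matrix_det ?_)).continuousOn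
    refine continuous_matrix fun i j => ?_
    simp only [borderedGram, Matrix.of_apply, borderedForm_apply]
    fun_prop
  exact h.congr fun p hp => levelGaussCurv_eq_det_div hn e hp p.2

theorem extendFrom_spec {F : Type*} [TopologicalSpace F] [RegularSpace F] [T2Space F]
    {f : Euc n → F} (h : ExtendsToClosure Ω f) :
    ContinuousOn (extendFrom Ω f) (closure Ω) ∧ EqOn (extendFrom Ω f) f Ω := by
  obtain ⟨g, hg, hgf⟩ := h
  have hlim : ∀ x ∈ closure Ω, Tendsto f (𝓝[Ω] x) (𝓝 (g x)) := fun x hx =>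
    ((hg x hx).mono_left (nhdsWithin_mono _ subset_closure)).congr'
      (hgf.eventuallyEq_of_mem self_mem_nhdsWithin)
  refine ⟨continuousOn_extendFrom subset_rfl fun x hx => ⟨_, hlim x hx⟩, fun x hx => ?_⟩
  rw [extendFrom_eq (subset_closure hx) (hlim x (subset_closure hx)), hgf hx]

theorem continuousOn_weightedCurv (hn : n = m + 1) (hu : IsC2UpToBoundary Ω u) (θ : ℝ) :
    ContinuousOn (weightedCurv Ω u θ) (regularSet Ω u) := by
  have hg : ContinuousOn (gradBar Ω u) (regularSet Ω u) :=
    (extendFrom_spec hu.2.2.1).1.mono fun x hx => hx.1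
  have hA : ContinuousOn (hessBar Ω u) (regularSet Ω u) :=
    (extendFrom_spec hu.2.2.2).1.mono fun x hx => hx.1
  have hK : ContinuousOn (fun x => levelGaussCurv (gradBar Ω u x) (hessBar Ω u x))
      (regularSet Ω u) :=
    (continuousOn_levelGaussCurv hn).comp (f := fun x => (gradBar Ω u x, hessBar Ω u x))
      (hg.prodMk hA) fun x hx => hx.2
  refine ContinuousOn.mul (ContinuousOn.rpow_const ?_ fun x hx => .inl ?_) hK
  · refine ContinuousOn.div (hg.norm.pow 2) (continuousOn_const.add (hg.norm.pow 2)) fun x _ => ?_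
    positivity
  · have := norm_pos_iff.mpr hx.2
    positivity

theorem weightedCurv_eq_exp (hu : IsC2UpToBoundary Ω u) {x : Euc n} (hx : x ∈ Ω)
    (hg : ∇ u x ≠ 0) (hK : 0 < levelGaussCurv (∇ u x) (hessianOp u x)) (θ : ℝ) :
    weightedCurv Ω u θ x = Real.exp (logCurv θ u x) := by
  have hg' := norm_pos_iff.mpr hg
  rw [weightedCurv, gradBar, hessBar, (extendFrom_spec hu.2.2.1).2 hx,
    (extendFrom_spec hu.2.2.2).2 hx, logCurv, Real.exp_add, Real.exp_log hK,
    ← Real.log_div (by positivity) (by positivity), Real.rpow_def_of_pos (by positivity)]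
  rw [mul_comm, mul_comm θ]

theorem subset_regularSet (hu : IsC2UpToBoundary Ω u) (hgrad : ∀ x ∈ Ω, ∇ u x ≠ 0) :
    Ω ⊆ regularSet Ω u := fun x hx =>
  ⟨subset_closure hx, by rw [gradBar, (extendFrom_spec hu.2.2.1).2 hx]; exact hgrad x hx⟩

end WeightedCurvature

/-! ### The differential inequality on Ω and the conclusion. -/

section DifferentialInequality

variable {n m : ℕ} {u : Euc n → ℝ} {Ω : Set (Euc n)} {x : Euc n}

/-- The weights of the linearized operator. -/
def operatorWeights (m : ℕ) (s : ℝ) : Fin m ⊕ Unit → ℝ := Sum.elim (fun _ => 1 + s ^ 2) fun _ => 1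

theorem LevelJet.sum_operatorWeights_mul (F : LevelJet m) (f : Fin m ⊕ Unit → ℝ) :
    ∑ l, operatorWeights m F.s l * f l = F.L f := by
  simp [operatorWeights, LevelJet.L, Finset.mul_sum]

theorem operatorWeights_bounds (m : ℕ) (s : ℝ) (l : Fin m ⊕ Unit) :
    1 ≤ operatorWeights m s l ∧ operatorWeights m s l ≤ 1 + s ^ 2 := by
  have := sq_nonneg s
  rcases l with l | l <;> simp [operatorWeights] <;> linarith

/-- The a_k and c are Hessian entries, hence bounded by the operator norm, and H ≤ (1 + s²) H = c/s.
So the lower order constant is controlled by a continuous function on Ω. -/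
theorem LevelJet.IsJetOf.bounds {F : LevelJet m}
    {e : OrthonormalBasis (Fin m ⊕ Unit) ℝ (Euc n)} (hF : F.IsJetOf u x e) (hΩ : IsOpen Ω)
    (hu : ContDiffOn ℝ 2 u Ω) (hx : x ∈ Ω) :
    (∀ k, F.s⁻¹ * |F.a k| ≤ ‖∇ u x‖⁻¹ * ‖hessianOp u x‖) ∧
      F.H ≤ ‖∇ u x‖⁻¹ * ‖hessianOp u x‖ := by
  have hs := F.s_pos
  have h : ∀ i j, |F.hess i j| ≤ ‖hessianOp u x‖ := by
    intro i j
    rw [← hF.hess, ← inner_hessianOp_eq_dirDeriv hΩ hu hx]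
    refine (abs_real_inner_le_norm _ _).trans ?_
    rw [e.norm_eq_one, one_mul]
    simpa using (hessianOp u x).le_opNorm (e j)
  rw [hF.norm_gradient]
  refine ⟨fun k => mul_le_mul_of_nonneg_left (h (.inl k) (.inr ())) (inv_nonneg.mpr hs.le), ?_⟩
  have h1 : F.c ≤ ‖hessianOp u x‖ := (le_abs_self _).trans (h (.inr ()) (.inr ()))
  have h2 : F.H ≤ (1 + F.s ^ 2) * F.H := le_mul_of_one_le_left F.H_nonneg (by nlinarith)
  refine h2.trans ?_
  rw [← div_eq_inv_mul, le_div_iff₀ hs]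
  refine le_trans (le_of_eq ?_) h1
  rw [LevelJet.c]; ring

theorem isSupersolutionAt_logCurv (hn : n = m + 1) (hm : 1 ≤ m) {θ : ℝ}
    (hθ : θ = -1 / 2 ∨ (2 ≤ m ∧ ((m : ℝ) - 2) / 2 ≤ θ)) (hΩ : IsOpen Ω)
    (hu : ContDiffOn ℝ 4 u Ω) (hmin : SolvesMinimalSurfaceEq Ω u) (hgrad : ∀ y ∈ Ω, ∇ u y ≠ 0)
    (hconv : StrictlyConvexLevelSets Ω u) (hx : x ∈ Ω) :
    IsSupersolutionAt (Fin m ⊕ Unit) (logCurv θ u)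
      (1 + ‖∇ u x‖ ^ 2 + LevelJet.lowerOrderConst m θ * (‖∇ u x‖⁻¹ * ‖hessianOp u x‖)) x := by
  have hu2 : ContDiffOn ℝ 2 u Ω := hu.of_le (by norm_num)
  obtain ⟨e, F, hF⟩ := exists_isJetOf hn hΩ hu hmin hx (hgrad x hx) (hconv x hx)
  obtain ⟨h1, h2⟩ := hF.equations hΩ hu hmin hx
  obtain ⟨ha, hH⟩ := hF.bounds hΩ hu2 hx
  have hD : 0 ≤ LevelJet.lowerOrderConst m θ := by rw [LevelJet.lowerOrderConst]; positivity
  have hD' : 0 ≤ LevelJet.lowerOrderConst m θ * (‖∇ u x‖⁻¹ * ‖hessianOp u x‖) := by positivity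
  refine ⟨e, operatorWeights m F.s, F.logCurv₁ θ, F.logCurv₂ θ, fun l => ?_, fun l => ?_, ?_⟩
  · have := operatorWeights_bounds m F.s l
    rw [hF.norm_gradient]
    rw [hF.norm_gradient] at hD'
    exact ⟨this.1, by linarith⟩
  · exact hF.hasJet_logCurv hn hΩ hu hgrad (fun y hy =>
      levelGaussCurv_pos (inner_hessianOp_symm hΩ hu2 hy) (hconv y hy)) hx θ l
  · rw [F.sum_operatorWeights_mul]
    refine (F.L_logCurv₂_le h1 h2 hm hθ ha hH).trans ?_
    refine mul_le_mul_of_nonneg_right ?_ (Finset.sum_nonneg fun _ _ => abs_nonneg _)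
    have := sq_nonneg ‖∇ u x‖
    linarith

theorem isSupersolutionAt_neg_exp_logCurv (hn : n = 2) (hΩ : IsOpen Ω)
    (hu : ContDiffOn ℝ 4 u Ω) (hmin : SolvesMinimalSurfaceEq Ω u) (hgrad : ∀ y ∈ Ω, ∇ u y ≠ 0)
    (hconv : StrictlyConvexLevelSets Ω u) (hx : x ∈ Ω) :
    IsSupersolutionAt (Fin 1 ⊕ Unit) (fun y => -Real.exp (logCurv (-1 / 2) u y))
      (1 + ‖∇ u x‖ ^ 2) x := by
  have hu2 : ContDiffOn ℝ 2 u Ω := hu.of_le (by norm_num)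
  obtain ⟨e, F, hF⟩ := exists_isJetOf (m := 1) hn hΩ hu hmin hx (hgrad x hx) (hconv x hx)
  obtain ⟨h1, h2⟩ := hF.equations hΩ hu hmin hx
  refine ⟨e, operatorWeights 1 F.s, _, _, fun l => ?_, fun l =>
    (hF.hasJet_logCurv hn hΩ hu hgrad (fun y hy =>
      levelGaussCurv_pos (inner_hessianOp_symm hΩ hu2 hy) (hconv y hy)) hx (-1 / 2) l).exp.neg, ?_⟩
  · rw [hF.norm_gradient]
    exact operatorWeights_bounds 1 F.s l
  -- The second derivatives of ψ = exp φ are ψ (φ_l² + φ_ll), and the weighted sum of these vanishes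
  -- by the two-dimensional identity.
  · have h : ∑ l, operatorWeights 1 F.s l * -(Real.exp (logCurv (-1 / 2) u x)
        * (F.logCurv₁ (-1 / 2) l ^ 2 + F.logCurv₂ (-1 / 2) l)) = 0 := by
      rw [Finset.sum_congr rfl fun l _ => (show operatorWeights 1 F.s l
        * -(Real.exp (logCurv (-1 / 2) u x) * (F.logCurv₁ (-1 / 2) l ^ 2 + F.logCurv₂ (-1 / 2) l))
        = -Real.exp (logCurv (-1 / 2) u x) * (operatorWeights 1 F.s l
          * (F.logCurv₁ (-1 / 2) l ^ 2 + F.logCurv₂ (-1 / 2) l)) by ring), ← Finset.mul_sum,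
        F.sum_operatorWeights_mul, F.L_add, F.L_logCurv₂_eq_of_dim_two h1 h2]
      ring
    rw [h]
    exact mul_nonneg (by positivity) (Finset.sum_nonneg fun _ _ => abs_nonneg _)

theorem constantOn_or_minOnBoundary_weightedCurv (hn : n = m + 1) (hm : 1 ≤ m) {θ : ℝ}
    (hθ : θ = -1 / 2 ∨ (2 ≤ m ∧ ((m : ℝ) - 2) / 2 ≤ θ)) (hΩ : IsOpen Ω) (hΩc : IsConnected Ω)
    (hΩb : Bornology.IsBounded Ω) (hu : ContDiffOn ℝ 4 u Ω) (hu2 : IsC2UpToBoundary Ω u)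
    (hmin : SolvesMinimalSurfaceEq Ω u) (hgrad : ∀ y ∈ Ω, ∇ u y ≠ 0)
    (hconv : StrictlyConvexLevelSets Ω u) :
    ConstantOn (regularSet Ω u) (weightedCurv Ω u θ) ∨
      MinOnBoundary Ω (regularSet Ω u) (weightedCurv Ω u θ) := by
  have hψc := continuousOn_weightedCurv hn hu2 θ
  have hsub := subset_regularSet hu2 hgrad
  have hexp : ∀ y ∈ Ω, weightedCurv Ω u θ y = Real.exp (logCurv θ u y) := fun y hy =>
    weightedCurv_eq_exp hu2 hy (hgrad y hy)
      (levelGaussCurv_pos (inner_hessianOp_symm hΩ hu2.1 hy) (hconv y hy)) θ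
  have hlog : ∀ y ∈ Ω, logCurv θ u y = Real.log (weightedCurv Ω u θ y) := fun y hy => by
    rw [hexp y hy, Real.log_exp]
  have hφc : ContinuousOn (logCurv θ u) Ω :=
    ((hψc.mono hsub).log fun y hy => by rw [hexp y hy]; exact (Real.exp_pos _).ne').congr hlog
  have hgc : ContinuousOn (∇ u) Ω := (hu2.1.gradient hΩ (j := 1) (by norm_num)).continuousOn
  have hAc : ContinuousOn (hessianOp u) Ω :=
    ((hu.gradient hΩ (j := 3) (by norm_num)).fderiv_of_isOpen hΩ (m := 0)
      (by norm_num)).continuousOn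
  refine constantOn_or_minOnBoundary hΩ hΩc.nonempty hΩb hsub (fun x hx => hx.1) hψc
    fun z hz hzm x hx => ?_
  have hC : ContinuousOn (fun x => 1 + ‖∇ u x‖ ^ 2
      + LevelJet.lowerOrderConst m θ * (‖∇ u x‖⁻¹ * ‖hessianOp u x‖)) Ω :=
    (continuousOn_const.add (hgc.norm.pow 2)).add (continuousOn_const.mul
      ((hgc.norm.inv₀ fun y hy => norm_ne_zero_iff.mpr (hgrad y hy)).mul hAc.norm))
  have := eq_of_isMinOn_of_isSupersolutionAt hΩ hΩc.isPreconnected hφc hC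
    (fun y hy => isSupersolutionAt_logCurv hn hm hθ hΩ hu hmin hgrad hconv hy) hz
    (fun y hy => by
      have := hzm y hy
      rwa [hexp y hy, hexp z hz, Real.exp_le_exp] at this) x hx
  rw [hexp x hx, hexp z hz, this]

theorem constantOn_or_maxOnBoundary_weightedCurv (hn : n = 2) (hΩ : IsOpen Ω)
    (hΩc : IsConnected Ω) (hΩb : Bornology.IsBounded Ω) (hu : ContDiffOn ℝ 4 u Ω)
    (hu2 : IsC2UpToBoundary Ω u) (hmin : SolvesMinimalSurfaceEq Ω u) (hgrad : ∀ y ∈ Ω, ∇ u y ≠ 0)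
    (hconv : StrictlyConvexLevelSets Ω u) :
    ConstantOn (regularSet Ω u) (weightedCurv Ω u (-1 / 2)) ∨
      MaxOnBoundary Ω (regularSet Ω u) (weightedCurv Ω u (-1 / 2)) := by
  have hψc := continuousOn_weightedCurv (m := 1) hn hu2 (-1 / 2)
  have hsub := subset_regularSet hu2 hgrad
  have hexp : ∀ y ∈ Ω, weightedCurv Ω u (-1 / 2) y = Real.exp (logCurv (-1 / 2) u y) :=
    fun y hy => weightedCurv_eq_exp hu2 hy (hgrad y hy)
      (levelGaussCurv_pos (inner_hessianOp_symm hΩ hu2.1 hy) (hconv y hy)) _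
  have hgc : ContinuousOn (∇ u) Ω := (hu2.1.gradient hΩ (j := 1) (by norm_num)).continuousOn
  refine constantOn_or_maxOnBoundary hΩ hΩc.nonempty hΩb hsub (fun x hx => hx.1) hψc
    fun z hz hzm x hx => ?_
  rw [hexp x hx, hexp z hz]
  refine eq_of_isMinOn_of_isSupersolutionAt (ι := Fin 1 ⊕ Unit)
    (φ := fun y => -Real.exp (logCurv (-1 / 2) u y)) (C := fun x => 1 + ‖∇ u x‖ ^ 2) hΩ
    hΩc.isPreconnected ((hψc.mono hsub).neg.congr fun y hy => by simp [hexp y hy])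
    (continuousOn_const.add (hgc.norm.pow 2))
    (fun y hy => isSupersolutionAt_neg_exp_logCurv hn hΩ hu hmin hgrad hconv hy) hz
    (fun y hy => by
      have := hzm y hy
      rwa [hexp y hy, hexp z hz] at this) x hx

end DifferentialInequality

theorem theorem1p1 (n : ℕ) (Ω : Set (Euc n)) (hΩo : IsOpen Ω) (hΩc : IsConnected Ω)
    (hΩb : Bornology.IsBounded Ω) (u : Euc n → ℝ) (hu4 : ContDiffOn ℝ 4 u Ω)
    (hu2 : IsC2UpToBoundary Ω u) (hmin : SolvesMinimalSurfaceEq Ω u)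
    (hgrad : ∀ x ∈ Ω, gradient u x ≠ 0) (hconv : StrictlyConvexLevelSets Ω u) :
    (n = 2 →
      ConstantOn (regularSet Ω u) (weightedCurv Ω u (-1 / 2)) ∨
        (MinOnBoundary Ω (regularSet Ω u) (weightedCurv Ω u (-1 / 2)) ∧
          MaxOnBoundary Ω (regularSet Ω u) (weightedCurv Ω u (-1 / 2)))) ∧
    (3 ≤ n → ∀ θ : ℝ, (θ = -1 / 2 ∨ ((n : ℝ) - 3) / 2 ≤ θ) →
      ConstantOn (regularSet Ω u) (weightedCurv Ω u θ) ∨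
        MinOnBoundary Ω (regularSet Ω u) (weightedCurv Ω u θ)) := by
  refine ⟨fun hn => ?_, fun hn θ hθ => ?_⟩
  · rcases constantOn_or_minOnBoundary_weightedCurv (m := 1) hn le_rfl (.inl rfl) hΩo hΩc hΩb hu4
      hu2 hmin hgrad hconv with h | h
    · exact .inl h
    · rcases constantOn_or_maxOnBoundary_weightedCurv hn hΩo hΩc hΩb hu4 hu2 hmin hgrad hconv
        with h' | h'
      · exact .inl h'
      · exact .inr ⟨h, h'⟩
  · obtain ⟨m, rfl⟩ : ∃ m, n = m + 1 := ⟨n - 1, by omega⟩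
    refine constantOn_or_minOnBoundary_weightedCurv rfl (by omega) ?_ hΩo hΩc hΩb hu4 hu2 hmin
      hgrad hconv
    -- With n = m + 1 the bound (n - 3)/2 becomes (m - 2)/2.
    refine hθ.imp_right fun h => ⟨by omega, ?_⟩
    push_cast at h
    linarith
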